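/- Let $\mathcal T$ be the Toeplitz algebra, i.e. the universal $C^*$-algebra generated by one isometry $s$ ($s^*s=1$), let $u$ be the generating unitary (the inclusion $S^1\subset\mathbb C$) of the $C^*$-algebra $C(S^1)=C(U(1))$, let $\sigma\colon\mathcal T\to C(S^1)$, $s\mapsto u$, be the symbol map, and let $\otimes$ denote the minimal tensor product of $C^*$-algebras. Let $S\colon C(S^1)\to C(S^1)$, $S(f)(z)=f(z^{-1})$, and write $\delta\colon\mathcal T\to\mathcal T\otimes C(S^1)$, $\delta(s)=s\otimes u$, as $\delta(t)=t_{(0)}\otimes t_{(1)}$. **The sphere.** Let $C(S^5_H)$ be the $C^*$-algebra of all triples $$(x_0,x_1,x_2)\in (C(S^1)\otimes\mathcal T\otimes\mathcal T)\times(\mathcal T\otimes C(S^1)\otimes\mathcal T)\times(\mathcal T\otimes\mathcal T\otimes C(S^1))$$ such that $$(\mathrm{id}\otimes\sigma\otimes\mathrm{id})(x_0)=(\sigma\otimes\mathrm{id}\otimes\mathrm{id})(x_1),\quad (\mathrm{id}\otimes\mathrm{id}\otimes\sigma)(x_0)=(\sigma\otimes\mathrm{id}\otimes\mathrm{id})(x_2),\quad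 (\mathrm{id}\otimes\mathrm{id}\otimes\sigma)(x_1)=(\mathrm{id}\otimes\sigma\otimes\mathrm{id})(x_2).$$ The group $U(1)$ acts on $\mathcal T$ by the gauge action $s\mapsto\lambda s$ and on $C(S^1)$ by $u\mapsto\lambda u$ (i.e. $f\mapsto f(\,\cdot\,\lambda)$). The induced actions on all tensor factors simultaneously define the diagonal action of $U(1)$ on $C(S^5_H)$ by $*$-automorphisms; let $C(S^5_H)^{U(1)}$ be its fixed-point subalgebra. **The projective plane.** Put $\sigma_1=\sigma\otimes\mathrm{id}$ and $\sigma_2=\mathrm{id}\otimes\sigma$ on $\mathcal T\otimes\mathcal T$, and let $$\Psi_{01}\colon C(S^1)\otimes\mathcal T\to C(S^1)\otimes\mathcal T,\quad v\otimes t\mapsto S(t_{(1)}v)\otimes t_{(0)},$$ $$\Psi_{02}\colon C(S^1)\otimes\mathcal T\to\mathcal T\otimes C(S^1),\quad v\otimes t\mapsto t_{(0)}\otimes S(t_{(1)}v),$$ $$\Psi_{12}\colon \mathcal T\otimes C(S^1)\to\mathcal T\otimes C(S^1),\quad t\otimes v\mapsto t_{(0)}\otimes S(t_{(1)}v).$$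 Let $C(\mathbb CP^2_{\mathcal T})$ be the $C^*$-algebra of all triples $(b_0,b_1,b_2)\in(\mathcal T\otimes\mathcal T)^3$ such that $$\sigma_1(b_0)=\Psi_{01}(\sigma_1(b_1)),\qquad \sigma_2(b_0)=\Psi_{02}(\sigma_1(b_2)),\qquad \sigma_2(b_1)=\Psi_{12}(\sigma_2(b_2)).$$ **Theorem.** The $C^*$-algebras $C(S^5_H)^{U(1)}$ and $C(\mathbb CP^2_{\mathcal T})$ are $*$-isomorphic. -/

import Mathlib

noncomputable section

open scoped TensorProduct ComplexConjugate
open UniformSpace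

namespace QuantumPlane

/-! ## Enveloping C*-algebras -/

/-- A nonempty, pointwise norm-bounded family of unital `*`-homomorphisms from a complex unital
`*`-algebra into C*-algebras. -/
structure CStarFamily (R : Type) [Ring R] [StarRing R] [Algebra ℂ R] [StarModule ℂ R] where
  Index : Type 1
  target : Index → Type
  [cstar : ∀ i, CStarAlgebra (target i)]
  hom : ∀ i, R →⋆ₐ[ℂ] target i
  bdd : ∀ x, ∃ C : ℝ, ∀ i, ‖hom i x‖ ≤ C
  nonempty : Nonempty Index

attribute [instance] CStarFamily.cstar CStarFamily.nonempty

namespace CStarFamily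

variable {R : Type} [Ring R] [StarRing R] [Algebra ℂ R] [StarModule ℂ R] (F : CStarFamily R)

/-- The C*-seminorm `x ↦ sup_i ‖f_i x‖`. -/
def sNorm (x : R) : ℝ := ⨆ i, ‖F.hom i x‖

theorem bddAbove (x : R) : BddAbove (Set.range fun i => ‖F.hom i x‖) := by
  obtain ⟨C, hC⟩ := F.bdd x
  exact ⟨C, by rintro _ ⟨i, rfl⟩; exact hC i⟩

theorem le_sNorm (i : F.Index) (x : R) : ‖F.hom i x‖ ≤ F.sNorm x := le_ciSup (F.bddAbove x) i

theorem sNorm_le {x : R} {C : ℝ} (h : ∀ i, ‖F.hom i x‖ ≤ C) : F.sNorm x ≤ C := ciSup_le h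

theorem sNorm_nonneg (x : R) : 0 ≤ F.sNorm x := Real.iSup_nonneg fun _ => norm_nonneg _

theorem sNorm_add (x y : R) : F.sNorm (x + y) ≤ F.sNorm x + F.sNorm y :=
  F.sNorm_le fun i => by
    rw [map_add]
    exact (norm_add_le _ _).trans (add_le_add (F.le_sNorm i x) (F.le_sNorm i y))

theorem sNorm_mul (x y : R) : F.sNorm (x * y) ≤ F.sNorm x * F.sNorm y :=
  F.sNorm_le fun i => by
    rw [map_mul]
    exact (norm_mul_le _ _).trans (mul_le_mul (F.le_sNorm i x) (F.le_sNorm i y) (norm_nonneg _)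
      (F.sNorm_nonneg x))

theorem sNorm_smul (c : ℂ) (x : R) : F.sNorm (c • x) ≤ ‖c‖ * F.sNorm x :=
  F.sNorm_le fun i => by
    rw [map_smul, norm_smul]
    exact mul_le_mul_of_nonneg_left (F.le_sNorm i x) (norm_nonneg _)

theorem sNorm_zero : F.sNorm 0 = 0 := by
  simp only [sNorm, map_zero, norm_zero, ciSup_const]

theorem sNorm_neg (x : R) : F.sNorm (-x) = F.sNorm x := by
  simp only [sNorm, map_neg, norm_neg]

theorem sNorm_star (x : R) : F.sNorm (star x) = F.sNorm x := by
  simp only [sNorm, map_star, norm_star]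

theorem sNorm_sq_le (x : R) : F.sNorm x * F.sNorm x ≤ F.sNorm (star x * x) := by
  have h : F.sNorm x ≤ √(F.sNorm (star x * x)) := F.sNorm_le fun i => by
    refine Real.le_sqrt_of_sq_le ?_
    rw [sq, ← CStarRing.norm_star_mul_self, ← map_star, ← map_mul]
    exact F.le_sNorm i _
  calc F.sNorm x * F.sNorm x ≤ √(F.sNorm (star x * x)) * √(F.sNorm (star x * x)) :=
        mul_self_le_mul_self (F.sNorm_nonneg x) h
    _ = _ := Real.mul_self_sqrt (F.sNorm_nonneg _)

/-- The `*`-algebra `R` equipped with the seminorm of the family. -/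
def Pre (_ : CStarFamily R) : Type := R

instance : Ring F.Pre := inferInstanceAs (Ring R)
instance : StarRing F.Pre := inferInstanceAs (StarRing R)
instance : Algebra ℂ F.Pre := inferInstanceAs (Algebra ℂ R)
instance : StarModule ℂ F.Pre := inferInstanceAs (StarModule ℂ R)

/-- The identity map from `R` to `R` with the seminorm of the family. -/
def toPre : R →⋆ₐ[ℂ] F.Pre := StarAlgHom.id ℂ R

instance : SeminormedAddCommGroup F.Pre :=
  AddGroupSeminorm.toSeminormedAddCommGroup
    { toFun := F.sNorm
      map_zero' := F.sNorm_zero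
      add_le' := F.sNorm_add
      neg' := F.sNorm_neg }

instance : SeminormedRing F.Pre where
  __ := (inferInstance : SeminormedAddCommGroup F.Pre)
  __ := (inferInstance : Ring F.Pre)
  norm_mul_le := F.sNorm_mul

instance : NormedSpace ℂ F.Pre where
  norm_smul_le := F.sNorm_smul

theorem norm_pre (x : F.Pre) : ‖x‖ = F.sNorm x := rfl

theorem uniformContinuous_star : UniformContinuous (star : F.Pre → F.Pre) := by
  have : Isometry (star : F.Pre → F.Pre) := by
    refine Isometry.of_dist_eq fun x y => ?_
    rw [dist_eq_norm, dist_eq_norm, ← star_sub]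
    exact F.sNorm_star _
  exact this.uniformContinuous

/-- The enveloping C*-algebra of `R` for the family `F`: the Hausdorff completion of `R` in the
C*-seminorm `sup_i ‖f_i x‖`. -/
def Envelope : Type := Completion F.Pre

instance : NormedRing F.Envelope := inferInstanceAs (NormedRing (Completion F.Pre))
instance : CompleteSpace F.Envelope := inferInstanceAs (CompleteSpace (Completion F.Pre))
instance : Algebra ℂ F.Envelope := inferInstanceAs (Algebra ℂ (Completion F.Pre))
instance : NormedAlgebra ℂ F.Envelope where
  norm_smul_le := norm_smul_le (α := ℂ) (β := Completion F.Pre)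

/-- The canonical map from `R` to its enveloping C*-algebra, as a function. -/
def coe (x : R) : F.Envelope := ((F.toPre x : F.Pre) : Completion F.Pre)

theorem denseRange_coe : DenseRange F.coe := Completion.denseRange_coe (α := F.Pre)

theorem norm_coe (x : R) : ‖F.coe x‖ = F.sNorm x := Completion.norm_coe (E := F.Pre) x

@[elab_as_elim]
theorem induction {p : F.Envelope → Prop} (a : F.Envelope) (hp : IsClosed {a | p a})
    (h : ∀ x, p (F.coe x)) : p a :=
  Completion.induction_on (α := F.Pre) a hp h

@[elab_as_elim]
theorem induction₂ {p : F.Envelope → F.Envelope → Prop} (a b : F.Envelope)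
    (hp : IsClosed {x : F.Envelope × F.Envelope | p x.1 x.2})
    (h : ∀ x y, p (F.coe x) (F.coe y)) : p a b :=
  Completion.induction_on₂ (α := F.Pre) (β := F.Pre) a b hp h

theorem coe_mul (x y : R) : F.coe (x * y) = F.coe x * F.coe y := Completion.coe_mul (α := F.Pre) x y
theorem coe_add (x y : R) : F.coe (x + y) = F.coe x + F.coe y := Completion.coe_add (α := F.Pre) x y
theorem coe_one : F.coe 1 = 1 := rfl
theorem coe_zero : F.coe 0 = 0 := rfl
theorem coe_smul (c : ℂ) (x : R) : F.coe (c • x) = c • F.coe x :=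
  Completion.coe_smul (X := F.Pre) c x

instance : Star F.Envelope := ⟨Completion.map (star : F.Pre → F.Pre)⟩

theorem coe_star (x : R) : F.coe (star x) = star (F.coe x) :=
  (Completion.map_coe F.uniformContinuous_star (F.toPre x)).symm

@[fun_prop]
theorem continuous_star_envelope : Continuous (star : F.Envelope → F.Envelope) :=
  Completion.continuous_map

instance : StarRing F.Envelope where
  star_involutive a := by
    refine F.induction a ?_ fun x => ?_
    · exact isClosed_eq (by fun_prop) (by fun_prop)
    rw [← coe_star, ← coe_star, star_star]
  star_mul a b := by
    refine F.induction₂ a b ?_ fun x y => ?_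
    · exact isClosed_eq (by fun_prop) (by fun_prop)
    rw [← coe_star, ← coe_star, ← coe_mul, ← coe_mul, ← coe_star, star_mul]
  star_add a b := by
    refine F.induction₂ a b ?_ fun x y => ?_
    · exact isClosed_eq (by fun_prop) (by fun_prop)
    rw [← coe_star, ← coe_star, ← coe_add, ← coe_add, ← coe_star, star_add]

instance : StarModule ℂ F.Envelope where
  star_smul c a := by
    refine F.induction a ?_ fun x => ?_
    · exact isClosed_eq (F.continuous_star_envelope.comp (continuous_const_smul c))
        ((continuous_const_smul (star c)).comp F.continuous_star_envelope)
    rw [← coe_star, ← coe_smul, ← coe_smul, ← coe_star, star_smul]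

instance : CStarRing F.Envelope where
  norm_mul_self_le a := by
    refine F.induction a ?_ fun x => ?_
    · exact isClosed_le (by fun_prop) (by fun_prop)
    rw [← coe_star, ← coe_mul, norm_coe, norm_coe]
    exact F.sNorm_sq_le x

instance : CStarAlgebra F.Envelope where

/-- The canonical `*`-homomorphism from `R` to its enveloping C*-algebra. -/
def of : R →⋆ₐ[ℂ] F.Envelope where
  toFun := F.coe
  map_one' := F.coe_one
  map_mul' := F.coe_mul
  map_zero' := F.coe_zero
  map_add' := F.coe_add
  commutes' c := by
    rw [Algebra.algebraMap_eq_smul_one, F.coe_smul, coe_one, Algebra.algebraMap_eq_smul_one]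
  map_star' := F.coe_star

theorem norm_of (x : R) : ‖F.of x‖ = F.sNorm x := F.norm_coe x

theorem denseRange_of : DenseRange F.of := F.denseRange_coe

@[elab_as_elim]
theorem induction_of {p : F.Envelope → Prop} (a : F.Envelope) (hp : IsClosed {a | p a})
    (h : ∀ x, p (F.of x)) : p a := F.induction a hp h

section lift

variable {D : Type*} [CStarAlgebra D] (f : R →⋆ₐ[ℂ] D)

/-- The extension by continuity of a `*`-homomorphism that is contractive for the seminorm. -/
def lift (hf : ∀ x, ‖f x‖ ≤ F.sNorm x) : F.Envelope →⋆ₐ[ℂ] D :=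
  have hc : UniformContinuous (fun x : F.Pre => f x) := by
    refine (LipschitzWith.of_dist_le_mul (K := 1) fun x y => ?_).uniformContinuous
    rw [dist_eq_norm, dist_eq_norm, NNReal.coe_one, one_mul]
    exact (congrArg norm (map_sub f x y)).symm.trans_le (hf _)
  let g : F.Envelope → D := Completion.extension (fun x : F.Pre => f x)
  have hg : Continuous g := Completion.continuous_extension
  have hgc : ∀ x, g (F.coe x) = f x := fun x => Completion.extension_coe hc (F.toPre x)
  { toFun := g
    map_one' := by rw [← F.coe_one, hgc, map_one]
    map_zero' := by rw [← F.coe_zero, hgc, map_zero]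
    map_mul' := fun a b => by
      refine F.induction₂ a b ?_ fun x y => ?_
      · exact isClosed_eq (by fun_prop) (by fun_prop)
      rw [← coe_mul, hgc, hgc, hgc, map_mul]
    map_add' := fun a b => by
      refine F.induction₂ a b ?_ fun x y => ?_
      · exact isClosed_eq (by fun_prop) (by fun_prop)
      rw [← coe_add, hgc, hgc, hgc, map_add]
    commutes' := fun c => by
      rw [Algebra.algebraMap_eq_smul_one, ← F.coe_one, ← F.coe_smul, hgc, map_smul, map_one,
        Algebra.algebraMap_eq_smul_one]
    map_star' := fun a => by
      refine F.induction a ?_ fun x => ?_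
      · exact isClosed_eq (by fun_prop) (by fun_prop)
      rw [← coe_star, hgc, hgc, map_star] }

theorem lift_of (hf : ∀ x, ‖f x‖ ≤ F.sNorm x) (x : R) : F.lift f hf (F.of x) = f x := by
  have hc : UniformContinuous (fun x : F.Pre => f x) := by
    refine (LipschitzWith.of_dist_le_mul (K := 1) fun x y => ?_).uniformContinuous
    rw [dist_eq_norm, dist_eq_norm, NNReal.coe_one, one_mul]
    exact (congrArg norm (map_sub f x y)).symm.trans_le (hf _)
  exact Completion.extension_coe hc (F.toPre x)

end lift

end CStarFamily

/-! ## The Toeplitz algebra -/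

/-- The free complex unital `*`-algebra on one generator: noncommutative polynomials in the
letters `s` (coded by `false`) and `s*` (coded by `true`). -/
def FreeStarAlg : Type := MonoidAlgebra ℂ (FreeMonoid Bool)

namespace FreeStarAlg

instance : Ring FreeStarAlg := inferInstanceAs (Ring (MonoidAlgebra ℂ (FreeMonoid Bool)))
instance : Algebra ℂ FreeStarAlg :=
  inferInstanceAs (Algebra ℂ (MonoidAlgebra ℂ (FreeMonoid Bool)))

/-- The monomial `c • w`. -/
def mono (w : FreeMonoid Bool) (c : ℂ) : FreeStarAlg := MonoidAlgebra.single w c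

theorem induction {p : FreeStarAlg → Prop} (x : FreeStarAlg) (zero : p 0)
    (add : ∀ x y, p x → p y → p (x + y)) (mono : ∀ w c, p (mono w c)) : p x :=
  MonoidAlgebra.induction_linear (R := ℂ) (M := FreeMonoid Bool) x zero add mono

theorem mono_mul (v w : FreeMonoid Bool) (a b : ℂ) :
    mono v a * mono w b = mono (v * w) (a * b) :=
  MonoidAlgebra.single_mul_single v w a b

theorem smul_mono (w : FreeMonoid Bool) (a b : ℂ) : a • mono w b = mono w (a * b) :=
  MonoidAlgebra.smul_single a w b

/-- The adjoint of a word: reverse it and exchange the letters `s` and `s*`. -/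
def wordStar (w : FreeMonoid Bool) : FreeMonoid Bool := FreeMonoid.map not (star w)

theorem wordStar_mul (v w : FreeMonoid Bool) : wordStar (v * w) = wordStar w * wordStar v := by
  simp [wordStar]

theorem wordStar_wordStar (w : FreeMonoid Bool) : wordStar (wordStar w) = w := by
  induction w using FreeMonoid.inductionOn' with
  | one => simp [wordStar]
  | of_mul x w ih =>
    rw [wordStar_mul, wordStar_mul, ih]
    simp [wordStar]

/-- The conjugate-linear extension of `wordStar`. -/
def starHom : FreeStarAlg →+ FreeStarAlg :=
  MonoidAlgebra.liftNC (R := FreeStarAlg) (k := ℂ) (G := FreeMonoid Bool)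
    ((algebraMap ℂ FreeStarAlg).comp (starRingEnd ℂ) : ℂ →+ FreeStarAlg)
    (fun w => mono (wordStar w) 1)

theorem starHom_mono (w : FreeMonoid Bool) (c : ℂ) :
    starHom (mono w c) = mono (wordStar w) (conj c) := by
  refine (MonoidAlgebra.liftNC_single _ _ _ _).trans ?_
  show algebraMap ℂ FreeStarAlg (conj c) * mono (wordStar w) 1 = _
  rw [← Algebra.smul_def, smul_mono, mul_one]

instance : Star FreeStarAlg := ⟨starHom⟩

theorem star_mono (w : FreeMonoid Bool) (c : ℂ) :
    star (mono w c) = mono (wordStar w) (conj c) := starHom_mono w c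

theorem star_add' (x y : FreeStarAlg) : star (x + y) = star x + star y := map_add starHom x y
theorem star_zero' : star (0 : FreeStarAlg) = 0 := map_zero starHom

instance : StarRing FreeStarAlg where
  star_involutive x := by
    induction x using induction with
    | zero => rw [star_zero', star_zero']
    | add x y hx hy => rw [star_add', star_add', hx, hy]
    | mono w c => rw [star_mono, star_mono, wordStar_wordStar, Complex.conj_conj]
  star_add := star_add'
  star_mul x y := by
    induction x using induction with
    | zero => rw [zero_mul, star_zero', mul_zero]
    | add x₁ x₂ h₁ h₂ => rw [add_mul, star_add', star_add', h₁, h₂, mul_add]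
    | mono v a =>
      induction y using induction with
      | zero => rw [mul_zero, star_zero', zero_mul]
      | add x₁ x₂ h₁ h₂ => rw [mul_add, star_add', star_add', h₁, h₂, add_mul]
      | mono w b =>
        rw [mono_mul, star_mono, star_mono, star_mono, mono_mul, wordStar_mul, map_mul, mul_comm]

instance : StarModule ℂ FreeStarAlg where
  star_smul a x := by
    induction x using induction with
    | zero => rw [smul_zero, star_zero', smul_zero]
    | add x₁ x₂ h₁ h₂ => rw [smul_add, star_add', star_add', h₁, h₂, smul_add]
    | mono w c =>
      rw [smul_mono, star_mono, star_mono, smul_mono, map_mul]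
      rfl

/-- The generator. -/
def gen : FreeStarAlg := mono (FreeMonoid.of false) 1

variable {D : Type} [CStarAlgebra D]

/-- The value of a word at `v`. -/
def wordEval (v : D) : FreeMonoid Bool →* D := FreeMonoid.lift fun b => bif b then star v else v

theorem wordEval_wordStar (v : D) (w : FreeMonoid Bool) :
    wordEval v (wordStar w) = star (wordEval v w) := by
  induction w using FreeMonoid.inductionOn' with
  | one => simp [wordStar]
  | of_mul x w ih =>
    rw [wordStar_mul, map_mul, ih, map_mul, star_mul]
    cases x <;> simp [wordStar, wordEval]

/-- Evaluation of noncommutative `*`-polynomials at `v`. -/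
def eval (v : D) : FreeStarAlg →⋆ₐ[ℂ] D where
  __ := MonoidAlgebra.lift ℂ D (FreeMonoid Bool) (wordEval v)
  map_star' x := by
    let f : FreeStarAlg →ₐ[ℂ] D := MonoidAlgebra.lift ℂ D (FreeMonoid Bool) (wordEval v)
    have hf : ∀ w c, f (mono w c) = c • wordEval v w := fun w c => MonoidAlgebra.lift_single _ _ _
    show f (star x) = star (f x)
    induction x using induction with
    | zero => rw [star_zero', map_zero, star_zero]
    | add x₁ x₂ h₁ h₂ => rw [star_add', map_add, map_add, h₁, h₂, star_add]
    | mono w c => rw [star_mono, hf, hf, wordEval_wordStar, star_smul]; rfl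

theorem eval_mono (v : D) (w : FreeMonoid Bool) (c : ℂ) : eval v (mono w c) = c • wordEval v w :=
  MonoidAlgebra.lift_single _ _ _

theorem eval_gen (v : D) : eval v gen = v := by
  rw [gen, eval_mono, one_smul]
  simp [wordEval]

/-- Two `*`-homomorphisms on the free `*`-algebra agree if they agree on the generator. -/
theorem hom_ext {f g : FreeStarAlg →⋆ₐ[ℂ] D} (h : f gen = g gen) (x : FreeStarAlg) :
    f x = g x := by
  have hg' : star gen = mono (FreeMonoid.of true) 1 := by
    rw [gen, star_mono, map_one]; simp [wordStar]
  induction x using induction with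
  | zero => rw [map_zero, map_zero]
  | add x₁ x₂ h₁ h₂ => rw [map_add, map_add, h₁, h₂]
  | mono w c =>
    have : mono w c = c • mono w 1 := by rw [smul_mono, mul_one]
    rw [this, map_smul, map_smul]
    congr 1
    induction w using FreeMonoid.inductionOn' with
    | one =>
      have : mono 1 1 = 1 := rfl
      rw [this, map_one, map_one]
    | of_mul b w ih =>
      have h2 : mono (FreeMonoid.of b * w) 1 = mono (FreeMonoid.of b) 1 * mono w 1 := by
        rw [mono_mul, mul_one]
      rw [h2, map_mul, map_mul, ih (by rw [smul_mono, mul_one])]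
      congr 1
      cases b
      · exact h
      · rw [← hg', map_star, map_star, h]

end FreeStarAlg

/-- An isometry in some unital C*-algebra. -/
structure IsometryIn : Type 1 where
  alg : Type
  [cstar : CStarAlgebra alg]
  v : alg
  star_mul_self : star v * v = 1

attribute [instance] IsometryIn.cstar

theorem norm_le_one_of_isometry {D : Type} [CStarAlgebra D] {v : D} (hv : star v * v = 1) :
    ‖v‖ ≤ 1 := by
  rcases subsingleton_or_nontrivial D with h | h
  · rw [Subsingleton.elim v 0, norm_zero]; exact zero_le_one
  · have := CStarRing.norm_star_mul_self (x := v)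
    rw [hv, CStarRing.norm_one] at this
    nlinarith [norm_nonneg v]

/-- All evaluations of `*`-polynomials at isometries in C*-algebras. -/
def toeplitzFamily : CStarFamily FreeStarAlg where
  Index := IsometryIn
  target V := V.alg
  hom V := FreeStarAlg.eval V.v
  bdd x := by
    induction x using FreeStarAlg.induction with
    | zero => exact ⟨0, fun i => by rw [map_zero, norm_zero]⟩
    | add x y hx hy =>
      obtain ⟨C, hC⟩ := hx
      obtain ⟨C', hC'⟩ := hy
      exact ⟨C + C', fun i => by
        rw [map_add]; exact (norm_add_le _ _).trans (add_le_add (hC i) (hC' i))⟩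
    | mono w c =>
      refine ⟨‖c‖, fun V => ?_⟩
      rw [FreeStarAlg.eval_mono, norm_smul]
      refine mul_le_of_le_one_right (norm_nonneg _) ?_
      have hv := norm_le_one_of_isometry V.star_mul_self
      induction w using FreeMonoid.inductionOn' with
      | one =>
        rw [map_one]
        rcases subsingleton_or_nontrivial V.alg with h | h
        · rw [Subsingleton.elim (1 : V.alg) 0, norm_zero]; exact zero_le_one
        · exact CStarRing.norm_one.le
      | of_mul b w ih =>
        rw [map_mul]
        refine (norm_mul_le _ _).trans (mul_le_one₀ ?_ (norm_nonneg _) ih)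
        cases b <;> simpa [FreeStarAlg.wordEval] using hv
  nonempty := ⟨{ alg := ℂ, v := 1, star_mul_self := by simp }⟩

/-- The Toeplitz algebra: the universal C*-algebra generated by one isometry. -/
def Toeplitz : Type := toeplitzFamily.Envelope

namespace Toeplitz

instance : CStarAlgebra Toeplitz := inferInstanceAs (CStarAlgebra toeplitzFamily.Envelope)

/-- The generating isometry. -/
def s : Toeplitz := toeplitzFamily.of FreeStarAlg.gen

theorem star_s_mul_s : star s * s = 1 := by
  have : toeplitzFamily.of (star FreeStarAlg.gen * FreeStarAlg.gen - 1) = 0 := by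
    rw [← norm_eq_zero, toeplitzFamily.norm_of]
    refine le_antisymm (toeplitzFamily.sNorm_le fun (V : IsometryIn) => ?_) (toeplitzFamily.sNorm_nonneg _)
    have : FreeStarAlg.eval V.v (star FreeStarAlg.gen * FreeStarAlg.gen - 1)
        = star V.v * V.v - 1 := by
      rw [map_sub, map_mul, map_star, map_one, FreeStarAlg.eval_gen]
    refine (congrArg norm this).trans_le ?_
    rw [V.star_mul_self]
    exact (norm_eq_zero.2 (sub_self _)).le
  rw [map_sub, map_mul, map_star, map_one, sub_eq_zero] at this
  exact this

variable {D : Type} [CStarAlgebra D]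

/-- The universal property: an isometry `v` determines the `*`-homomorphism with `s ↦ v`. -/
def lift (v : D) (hv : star v * v = 1) : Toeplitz →⋆ₐ[ℂ] D :=
  toeplitzFamily.lift (FreeStarAlg.eval v)
    fun x => toeplitzFamily.le_sNorm ({ alg := D, v := v, star_mul_self := hv } : IsometryIn) x

theorem lift_s (v : D) (hv : star v * v = 1) : lift v hv s = v :=
  (toeplitzFamily.lift_of _ _ _).trans (FreeStarAlg.eval_gen v)

theorem hom_ext {f g : Toeplitz →⋆ₐ[ℂ] D} (h : f s = g s) : f = g := by
  refine StarAlgHom.ext fun a => ?_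
  have hf : Continuous f := NonUnitalStarAlgHom.instContinuousLinearMapClassComplex.map_continuous f
  have hg : Continuous g := NonUnitalStarAlgHom.instContinuousLinearMapClassComplex.map_continuous g
  refine toeplitzFamily.induction_of (p := fun a => f a = g a) a (isClosed_eq hf hg) fun x => ?_
  exact FreeStarAlg.hom_ext (f := f.comp toeplitzFamily.of) (g := g.comp toeplitzFamily.of) h x

end Toeplitz

/-! ## The minimal tensor product -/

section Hilbert

set_option linter.unusedSectionVars false

variable (H K : Type) [NormedAddCommGroup H] [InnerProductSpace ℂ H] [CompleteSpace H]
  [NormedAddCommGroup K] [InnerProductSpace ℂ K] [CompleteSpace K]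

/-- The Hilbert space tensor product. -/
abbrev HilbertTensor : Type := Completion (H ⊗[ℂ] K)

variable {H K}

/-- The bounded operator `S ⊗ T` on the Hilbert space tensor product. -/
def opTensor (S : H →L[ℂ] H) (T : K →L[ℂ] K) : HilbertTensor H K →L[ℂ] HilbertTensor H K :=
  (TensorProduct.mapL S T).completion

theorem opTensor_tmul (S : H →L[ℂ] H) (T : K →L[ℂ] K) (x : H) (y : K) :
    opTensor S T ((x ⊗ₜ[ℂ] y : H ⊗[ℂ] K) : HilbertTensor H K) =
      ((S x ⊗ₜ[ℂ] T y : H ⊗[ℂ] K) : HilbertTensor H K) := by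
  rw [opTensor, ContinuousLinearMap.completion_apply_coe, TensorProduct.mapL_tmul]

/-- Bounded operators on the Hilbert tensor product agree if they agree on elementary tensors. -/
theorem op_ext {S T : HilbertTensor H K →L[ℂ] HilbertTensor H K}
    (h : ∀ (x : H) (y : K), S ((x ⊗ₜ[ℂ] y : H ⊗[ℂ] K) : HilbertTensor H K) =
      T ((x ⊗ₜ[ℂ] y : H ⊗[ℂ] K) : HilbertTensor H K)) : S = T := by
  ext z
  induction z using Completion.induction_on with
  | hp => exact isClosed_eq S.continuous T.continuous
  | ih z =>
    induction z using TensorProduct.induction_on with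
    | zero => rw [Completion.coe_zero, map_zero, map_zero]
    | tmul x y => exact h x y
    | add x y hx hy => rw [Completion.coe_add, map_add, map_add, hx, hy]

theorem opTensor_mul (S S' : H →L[ℂ] H) (T T' : K →L[ℂ] K) :
    opTensor (S * S') (T * T') = opTensor S T * opTensor S' T' :=
  op_ext fun x y => by
    rw [mul_apply_eq_comp, opTensor_tmul, opTensor_tmul, opTensor_tmul]; rfl

theorem opTensor_one : opTensor (1 : H →L[ℂ] H) (1 : K →L[ℂ] K) = 1 :=
  op_ext fun x y => by rw [opTensor_tmul]; rfl

theorem opTensor_add_left (S S' : H →L[ℂ] H) (T : K →L[ℂ] K) :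
    opTensor (S + S') T = opTensor S T + opTensor S' T :=
  op_ext fun x y => by
    rw [_root_.add_apply, opTensor_tmul, opTensor_tmul, opTensor_tmul,
      _root_.add_apply, TensorProduct.add_tmul, Completion.coe_add]

theorem opTensor_add_right (S : H →L[ℂ] H) (T T' : K →L[ℂ] K) :
    opTensor S (T + T') = opTensor S T + opTensor S T' :=
  op_ext fun x y => by
    rw [_root_.add_apply, opTensor_tmul, opTensor_tmul, opTensor_tmul,
      _root_.add_apply, TensorProduct.tmul_add, Completion.coe_add]

theorem opTensor_smul_left (c : ℂ) (S : H →L[ℂ] H) (T : K →L[ℂ] K) :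
    opTensor (c • S) T = c • opTensor S T :=
  op_ext fun x y => by
    rw [_root_.smul_apply, opTensor_tmul, opTensor_tmul,
      _root_.smul_apply, ← TensorProduct.smul_tmul', Completion.coe_smul]

theorem opTensor_smul_right (c : ℂ) (S : H →L[ℂ] H) (T : K →L[ℂ] K) :
    opTensor S (c • T) = c • opTensor S T :=
  op_ext fun x y => by
    rw [_root_.smul_apply, opTensor_tmul, opTensor_tmul,
      _root_.smul_apply, TensorProduct.tmul_smul, Completion.coe_smul]

theorem opTensor_star (S : H →L[ℂ] H) (T : K →L[ℂ] K) :
    opTensor (star S) (star T) = star (opTensor S T) := by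
  refine (ContinuousLinearMap.eq_adjoint_iff _ _).mpr fun z w => ?_
  induction z using Completion.induction_on with
  | hp => exact isClosed_eq (by fun_prop) (by fun_prop)
  | ih z =>
  induction w using Completion.induction_on with
  | hp => exact isClosed_eq (by fun_prop) (by fun_prop)
  | ih w =>
  induction z using TensorProduct.induction_on with
  | zero => simp only [Completion.coe_zero, map_zero, inner_zero_left]
  | add x y hx hy => simp only [Completion.coe_add, map_add, inner_add_left, hx, hy]
  | tmul x y =>
    induction w using TensorProduct.induction_on with
    | zero => simp only [Completion.coe_zero, map_zero, inner_zero_right]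
    | add x y hx hy => simp only [Completion.coe_add, map_add, inner_add_right, hx, hy]
    | tmul x' y' =>
      rw [opTensor_tmul, opTensor_tmul, Completion.inner_coe, Completion.inner_coe,
        TensorProduct.inner_tmul, TensorProduct.inner_tmul, ContinuousLinearMap.star_eq_adjoint,
        ContinuousLinearMap.star_eq_adjoint, ContinuousLinearMap.adjoint_inner_left,
        ContinuousLinearMap.adjoint_inner_left]

/-- The C*-algebra of bounded operators on a Hilbert space. -/
def BOp (H : Type) [NormedAddCommGroup H] [InnerProductSpace ℂ H] [CompleteSpace H] : Type :=
  H →L[ℂ] H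

instance : CStarAlgebra (BOp H) := inferInstanceAs (CStarAlgebra (H →L[ℂ] H))

variable (H K) in
/-- `S ↦ S ⊗ 1`. -/
def opLeft : BOp H →⋆ₐ[ℂ] BOp (HilbertTensor H K) where
  toFun S := opTensor S 1
  map_one' := opTensor_one
  map_mul' S S' := (congrArg (opTensor _) (mul_one _).symm).trans (opTensor_mul S S' 1 1)
  map_zero' := by
    have := opTensor_smul_left (0 : ℂ) (0 : H →L[ℂ] H) (1 : K →L[ℂ] K)
    rwa [zero_smul, zero_smul] at this
  map_add' S S' := opTensor_add_left S S' 1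
  commutes' c := by
    have := opTensor_smul_left c (1 : H →L[ℂ] H) (1 : K →L[ℂ] K)
    rw [opTensor_one] at this
    rw [Algebra.algebraMap_eq_smul_one, Algebra.algebraMap_eq_smul_one]
    exact this
  map_star' S := by
    have := opTensor_star (S : H →L[ℂ] H) (1 : K →L[ℂ] K)
    rw [star_one] at this
    exact this

variable (H K) in
/-- `T ↦ 1 ⊗ T`. -/
def opRight : BOp K →⋆ₐ[ℂ] BOp (HilbertTensor H K) where
  toFun T := opTensor 1 T
  map_one' := opTensor_one
  map_mul' T T' := (congrArg (opTensor · _) (mul_one _).symm).trans (opTensor_mul 1 1 T T')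
  map_zero' := by
    have := opTensor_smul_right (0 : ℂ) (1 : H →L[ℂ] H) (0 : K →L[ℂ] K)
    rwa [zero_smul, zero_smul] at this
  map_add' T T' := opTensor_add_right 1 T T'
  commutes' c := by
    have := opTensor_smul_right c (1 : H →L[ℂ] H) (1 : K →L[ℂ] K)
    rw [opTensor_one] at this
    rw [Algebra.algebraMap_eq_smul_one, Algebra.algebraMap_eq_smul_one]
    exact this
  map_star' T := by
    have := opTensor_star (1 : H →L[ℂ] H) (T : K →L[ℂ] K)
    rw [star_one] at this
    exact this

theorem opLeft_mul_opRight (S : BOp H) (T : BOp K) :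
    opLeft H K S * opRight H K T = opTensor S T :=
  (opTensor_mul S 1 1 T).symm.trans (congrArg₂ opTensor (mul_one _) (one_mul _))

theorem opRight_mul_opLeft (S : BOp H) (T : BOp K) :
    opRight H K T * opLeft H K S = opTensor S T :=
  (opTensor_mul 1 S T 1).symm.trans (congrArg₂ opTensor (one_mul _) (mul_one _))

end Hilbert

section Tensor

variable {A B A' B' A'' B'' : Type} [CStarAlgebra A] [CStarAlgebra B] [CStarAlgebra A']
  [CStarAlgebra B'] [CStarAlgebra A''] [CStarAlgebra B'']

section alg

variable {D : Type*} [Semiring D] [StarRing D] [Algebra ℂ D]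

/-- Two `*`-homomorphisms with commuting ranges define one on the algebraic tensor product by
`a ⊗ b ↦ f a * g b`. -/
def algLift (f : A →⋆ₐ[ℂ] D) (g : B →⋆ₐ[ℂ] D) (h : ∀ a b, Commute (f a) (g b)) :
    (A ⊗[ℂ] B) →⋆ₐ[ℂ] D where
  __ := Algebra.TensorProduct.lift f.toAlgHom g.toAlgHom h
  map_star' x := by
    let F : (A ⊗[ℂ] B) →ₐ[ℂ] D := Algebra.TensorProduct.lift f.toAlgHom g.toAlgHom h
    have hF : ∀ a b, F (a ⊗ₜ b) = f a * g b := fun a b => Algebra.TensorProduct.lift_tmul _ _ _ _ _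
    show F (star x) = star (F x)
    induction x using TensorProduct.induction_on with
    | zero => rw [star_zero, map_zero, star_zero]
    | add x y hx hy => rw [star_add, map_add, map_add, hx, hy, star_add]
    | tmul a b =>
      rw [TensorProduct.star_tmul, hF, hF, map_star, map_star, star_mul, ← map_star, ← map_star]
      exact h _ _

theorem algLift_tmul (f : A →⋆ₐ[ℂ] D) (g : B →⋆ₐ[ℂ] D) (h : ∀ a b, Commute (f a) (g b))
    (a : A) (b : B) : algLift f g h (a ⊗ₜ b) = f a * g b :=
  Algebra.TensorProduct.lift_tmul f.toAlgHom g.toAlgHom h a b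

theorem alg_hom_ext {f g : (A ⊗[ℂ] B) →⋆ₐ[ℂ] D} (h : ∀ a b, f (a ⊗ₜ b) = g (a ⊗ₜ b))
    (x : A ⊗[ℂ] B) : f x = g x := by
  induction x using TensorProduct.induction_on with
  | zero => rw [map_zero, map_zero]
  | add x y hx hy => rw [map_add, map_add, hx, hy]
  | tmul a b => exact h a b

end alg

/-- A unital representation of `A` on a Hilbert space. -/
structure HilbertRep (A : Type) [CStarAlgebra A] : Type 1 where
  space : Type
  [normed : NormedAddCommGroup space]
  [inner : InnerProductSpace ℂ space]
  [complete : CompleteSpace space]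
  π : A →⋆ₐ[ℂ] BOp space

attribute [instance] HilbertRep.normed HilbertRep.inner HilbertRep.complete

theorem pairRep_commute (π : HilbertRep A) (ρ : HilbertRep B) (a : A) (b : B) :
    Commute ((opLeft π.space ρ.space).comp π.π a) ((opRight π.space ρ.space).comp ρ.π b) :=
  (opLeft_mul_opRight (π.π a) (ρ.π b)).trans (opRight_mul_opLeft _ _).symm

/-- The representation `π ⊗ ρ` of the algebraic tensor product on the Hilbert tensor product. -/
def pairRep (π : HilbertRep A) (ρ : HilbertRep B) :
    (A ⊗[ℂ] B) →⋆ₐ[ℂ] BOp (HilbertTensor π.space ρ.space) :=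
  algLift ((opLeft π.space ρ.space).comp π.π) ((opRight π.space ρ.space).comp ρ.π)
    (pairRep_commute π ρ)

theorem pairRep_tmul (π : HilbertRep A) (ρ : HilbertRep B) (a : A) (b : B) :
    pairRep π ρ (a ⊗ₜ b) = opLeft π.space ρ.space (π.π a) * opRight π.space ρ.space (ρ.π b) :=
  algLift_tmul _ _ (pairRep_commute π ρ) a b

variable (A B) in
/-- All representations `π ⊗ ρ` of the algebraic tensor product. -/
def tensorFamily : CStarFamily (A ⊗[ℂ] B) where
  Index := HilbertRep A × HilbertRep B
  target i := BOp (HilbertTensor i.1.space i.2.space)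
  hom i := pairRep i.1 i.2
  bdd x := by
    induction x using TensorProduct.induction_on with
    | zero => exact ⟨0, fun i => by rw [map_zero, norm_zero]⟩
    | add x y hx hy =>
      obtain ⟨C, hC⟩ := hx
      obtain ⟨C', hC'⟩ := hy
      exact ⟨C + C', fun i => by
        rw [map_add]; exact (norm_add_le _ _).trans (add_le_add (hC i) (hC' i))⟩
    | tmul a b =>
      refine ⟨‖a‖ * ‖b‖, fun i => ?_⟩
      rw [pairRep_tmul]
      exact (norm_mul_le _ _).trans (mul_le_mul
        (NonUnitalStarAlgHom.norm_apply_le ((opLeft i.1.space i.2.space).comp i.1.π) a)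
        (NonUnitalStarAlgHom.norm_apply_le ((opRight i.1.space i.2.space).comp i.2.π) b) (norm_nonneg _) (norm_nonneg _))
  nonempty := by
    have h : Subsingleton (BOp PUnit) :=
      ⟨fun S T => ContinuousLinearMap.ext (M₁ := PUnit) (M₂ := PUnit) fun _ => rfl⟩
    let this (A : Type) [CStarAlgebra A] : HilbertRep A :=
      { space := PUnit
        π :=
          { toFun := fun _ => 0
            map_one' := h.elim _ _
            map_mul' := fun _ _ => h.elim _ _
            map_zero' := rfl
            map_add' := fun _ _ => h.elim _ _
            commutes' := fun _ => h.elim _ _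
            map_star' := fun _ => h.elim _ _ } }
    exact ⟨this A, this B⟩

variable (A B) in
/-- The minimal (spatial) tensor product of C*-algebras: the completion of the algebraic tensor
product in the norm `sup ‖(π ⊗ ρ)(x)‖` over all pairs of Hilbert space representations. -/
def MinTensor : Type := (tensorFamily A B).Envelope

namespace MinTensor

instance : CStarAlgebra (MinTensor A B) := inferInstanceAs (CStarAlgebra (tensorFamily A B).Envelope)

variable (A B) in
/-- The canonical map from the algebraic to the minimal tensor product. -/
def of : (A ⊗[ℂ] B) →⋆ₐ[ℂ] MinTensor A B := (tensorFamily A B).of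

/-- The elementary tensor `a ⊗ b`. -/
def tmul (a : A) (b : B) : MinTensor A B := of A B (a ⊗ₜ b)

theorem tmul_mul (a a' : A) (b b' : B) : tmul a b * tmul a' b' = tmul (a * a') (b * b') := by
  rw [tmul, tmul, ← map_mul, Algebra.TensorProduct.tmul_mul_tmul]; rfl

theorem one_def : (1 : MinTensor A B) = tmul 1 1 := (map_one (of A B)).symm

theorem star_tmul (a : A) (b : B) : star (tmul a b) = tmul (star a) (star b) := by
  rw [tmul, ← map_star, TensorProduct.star_tmul]; rfl

variable (A B) in
/-- `a ↦ a ⊗ 1`. -/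
def inl : A →⋆ₐ[ℂ] MinTensor A B where
  toFun a := tmul a 1
  map_one' := one_def.symm
  map_mul' a a' := by rw [tmul_mul, mul_one]
  map_zero' := by rw [tmul, TensorProduct.zero_tmul, map_zero]
  map_add' a a' := by rw [tmul, TensorProduct.add_tmul, map_add]; rfl
  commutes' c := by
    rw [Algebra.algebraMap_eq_smul_one, tmul, ← TensorProduct.smul_tmul', map_smul,
      Algebra.algebraMap_eq_smul_one, one_def]; rfl
  map_star' a := by rw [star_tmul, star_one]

variable (A B) in
/-- `b ↦ 1 ⊗ b`. -/
def inr : B →⋆ₐ[ℂ] MinTensor A B where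
  toFun b := tmul 1 b
  map_one' := one_def.symm
  map_mul' a a' := by rw [tmul_mul, mul_one]
  map_zero' := by rw [tmul, TensorProduct.tmul_zero, map_zero]
  map_add' a a' := by rw [tmul, TensorProduct.tmul_add, map_add]; rfl
  commutes' c := by
    rw [Algebra.algebraMap_eq_smul_one, tmul, TensorProduct.tmul_smul, map_smul,
      Algebra.algebraMap_eq_smul_one, one_def]; rfl
  map_star' a := by rw [star_tmul, star_one]

theorem inl_mul_inr (a : A) (b : B) : inl A B a * inr A B b = tmul a b := by
  show tmul a 1 * tmul 1 b = _
  rw [tmul_mul, mul_one, one_mul]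

theorem inr_mul_inl (a : A) (b : B) : inr A B b * inl A B a = tmul a b := by
  show tmul 1 b * tmul a 1 = _
  rw [tmul_mul, mul_one, one_mul]

theorem commute_inl_inr (a : A) (b : B) : Commute (inl A B a) (inr A B b) :=
  (inl_mul_inr a b).trans (inr_mul_inl a b).symm

variable {D : Type} [CStarAlgebra D]

theorem hom_ext {f g : MinTensor A B →⋆ₐ[ℂ] D} (h : ∀ a b, f (tmul a b) = g (tmul a b)) :
    f = g := by
  refine StarAlgHom.ext fun x => ?_
  have hf : Continuous f := NonUnitalStarAlgHom.instContinuousLinearMapClassComplex.map_continuous f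
  have hg : Continuous g := NonUnitalStarAlgHom.instContinuousLinearMapClassComplex.map_continuous g
  refine (tensorFamily A B).induction_of (p := fun a => f a = g a) x (isClosed_eq hf hg) fun x => ?_
  exact alg_hom_ext (f := f.comp (of A B)) (g := g.comp (of A B)) h x

/-- The extension by continuity of a contractive `*`-homomorphism on the algebraic tensor
product. -/
def lift (f : (A ⊗[ℂ] B) →⋆ₐ[ℂ] D) (hf : ∀ x, ‖f x‖ ≤ ‖of A B x‖) : MinTensor A B →⋆ₐ[ℂ] D :=
  (tensorFamily A B).lift f fun x => (hf x).trans_eq ((tensorFamily A B).norm_of x)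

theorem lift_of (f : (A ⊗[ℂ] B) →⋆ₐ[ℂ] D) (hf : ∀ x, ‖f x‖ ≤ ‖of A B x‖) (x : A ⊗[ℂ] B) :
    lift f hf (of A B x) = f x := (tensorFamily A B).lift_of _ _ _

theorem norm_pairRep_le (π : HilbertRep A) (ρ : HilbertRep B) (x : A ⊗[ℂ] B) :
    ‖pairRep π ρ x‖ ≤ ‖of A B x‖ :=
  ((tensorFamily A B).le_sNorm (π, ρ) x).trans_eq ((tensorFamily A B).norm_of x).symm

theorem norm_of_le {x : A ⊗[ℂ] B} {C : ℝ}
    (h : ∀ (π : HilbertRep A) (ρ : HilbertRep B), ‖pairRep π ρ x‖ ≤ C) : ‖of A B x‖ ≤ C :=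
  ((tensorFamily A B).norm_of x).trans_le
    ((tensorFamily A B).sNorm_le fun i : HilbertRep A × HilbertRep B => h i.1 i.2)

/-- The pull-back of a representation. -/
def _root_.QuantumPlane.HilbertRep.comap (φ : A →⋆ₐ[ℂ] A') (π : HilbertRep A') : HilbertRep A where
  space := π.space
  π := π.π.comp φ

/-- The algebraic tensor product of two `*`-homomorphisms. -/
def algMap (φ : A →⋆ₐ[ℂ] A') (ψ : B →⋆ₐ[ℂ] B') : (A ⊗[ℂ] B) →⋆ₐ[ℂ] (A' ⊗[ℂ] B') where
  __ := Algebra.TensorProduct.map φ.toAlgHom ψ.toAlgHom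
  map_star' x := by
    let F : (A ⊗[ℂ] B) →ₐ[ℂ] (A' ⊗[ℂ] B') := Algebra.TensorProduct.map φ.toAlgHom ψ.toAlgHom
    have hF : ∀ a b, F (a ⊗ₜ b) = φ a ⊗ₜ ψ b := fun a b => Algebra.TensorProduct.map_tmul _ _ _ _
    show F (star x) = star (F x)
    induction x using TensorProduct.induction_on with
    | zero => rw [star_zero, map_zero, star_zero]
    | add x y hx hy => rw [star_add, map_add, map_add, hx, hy, star_add]
    | tmul a b =>
      rw [TensorProduct.star_tmul, hF, hF, map_star, map_star, TensorProduct.star_tmul]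

theorem algMap_tmul (φ : A →⋆ₐ[ℂ] A') (ψ : B →⋆ₐ[ℂ] B') (a : A) (b : B) :
    algMap φ ψ (a ⊗ₜ b) = φ a ⊗ₜ ψ b := Algebra.TensorProduct.map_tmul _ _ _ _

theorem pairRep_algMap (φ : A →⋆ₐ[ℂ] A') (ψ : B →⋆ₐ[ℂ] B') (π : HilbertRep A')
    (ρ : HilbertRep B') (x : A ⊗[ℂ] B) :
    pairRep π ρ (algMap φ ψ x) = pairRep (HilbertRep.comap φ π) (HilbertRep.comap ψ ρ) x := by
  induction x using TensorProduct.induction_on with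
  | zero => rw [map_zero, map_zero, map_zero]; rfl
  | add x y hx hy => rw [map_add, map_add, map_add, hx, hy]; rfl
  | tmul a b => rw [algMap_tmul, pairRep_tmul, pairRep_tmul]; rfl

/-- The tensor product `φ ⊗ ψ` of two `*`-homomorphisms. -/
def map (φ : A →⋆ₐ[ℂ] A') (ψ : B →⋆ₐ[ℂ] B') : MinTensor A B →⋆ₐ[ℂ] MinTensor A' B' :=
  lift ((of A' B').comp (algMap φ ψ)) fun x => by
    rw [StarAlgHom.comp_apply]
    refine (MinTensor.norm_of_le fun π ρ => ?_)
    rw [pairRep_algMap]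
    exact norm_pairRep_le (HilbertRep.comap φ π) (HilbertRep.comap ψ ρ) x

theorem map_tmul (φ : A →⋆ₐ[ℂ] A') (ψ : B →⋆ₐ[ℂ] B') (a : A) (b : B) :
    map φ ψ (tmul a b) = tmul (φ a) (ψ b) := by
  rw [map, tmul, lift_of, StarAlgHom.comp_apply, algMap_tmul, tmul]

theorem map_comp (φ : A →⋆ₐ[ℂ] A') (ψ : B →⋆ₐ[ℂ] B') (φ' : A' →⋆ₐ[ℂ] A'') (ψ' : B' →⋆ₐ[ℂ] B'') :
    (map φ' ψ').comp (map φ ψ) = map (φ'.comp φ) (ψ'.comp ψ) :=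
  hom_ext fun a b => by
    rw [StarAlgHom.comp_apply, map_tmul, map_tmul, map_tmul]; rfl

theorem map_id : map (StarAlgHom.id ℂ A) (StarAlgHom.id ℂ B) = StarAlgHom.id ℂ _ :=
  hom_ext fun _ _ => map_tmul _ _ _ _

end MinTensor

end Tensor

/-! ## Homomorphisms out of `C(S¹) ⊗ A` -/

section Nuclear

/-- A convex combination, with coefficients commuting with everything in sight, of elements of
norm at most `M` has norm at most `M`. -/
theorem norm_convex_le {D : Type} [CStarAlgebra D] {ι : Type} [Fintype ι] (r b : ι → D)
    (hr : ∀ k, star (r k) = r k) (hrr : ∀ j k, Commute (r j) (r k))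
    (hrb : ∀ j k, Commute (r j) (b k)) (hsum : ∑ k, r k * r k = 1) {M : ℝ} (hM : 0 ≤ M)
    (hb : ∀ k, ‖b k‖ ≤ M) : ‖∑ k, r k * r k * b k‖ ≤ M := by
  let _ := CStarAlgebra.spectralOrder D
  have _ := CStarAlgebra.spectralOrderedRing D
  set T : D := ∑ k, r k * r k * b k with hT
  have hrbs : ∀ j k, Commute (r j) (star (b k)) := fun j k => by
    have := (hrb j k).star_star
    rwa [hr] at this
  have hrT : ∀ j, Commute (r j) T := fun j => by
    refine Commute.sum_right _ _ _ fun k _ => ?_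
    exact ((hrr j k).mul_right (hrr j k)).mul_right (hrb j k)
  have hrTs : ∀ j, Commute (r j) (star T) := fun j => by
    have := (hrT j).star_star
    rwa [hr] at this
  have hTs : star T = ∑ k, r k * r k * star (b k) := by
    rw [hT, star_sum]
    refine Finset.sum_congr rfl fun k _ => ?_
    rw [star_mul, star_mul, hr]
    exact (((hrbs k k).mul_left (hrbs k k)).eq).symm
  let m : D := algebraMap ℝ D (M ^ 2)
  have key : m - star T * T =
      ∑ k, r k * ((m - star (b k) * b k) + star (b k - T) * (b k - T)) * r k := by
    have h1 : ∀ k, r k * ((m - star (b k) * b k) + star (b k - T) * (b k - T)) * r k =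
        r k * r k * m - r k * r k * star (b k) * T - star T * (r k * r k * b k)
          + r k * r k * (star T * T) := by
      intro k
      have hm : Commute (r k) m := (Algebra.commutes (M ^ 2) (r k)).symm
      have hc : Commute (r k) ((m - star (b k) * b k) + star (b k - T) * (b k - T)) := by
        rw [star_sub]
        exact (hm.sub_right ((hrbs k k).mul_right (hrb k k))).add_right
          (((hrbs k k).sub_right (hrTs k)).mul_right ((hrb k k).sub_right (hrT k)))
      have e : star T * (r k * r k * b k) = r k * r k * (star T * b k) := by
        rw [← mul_assoc, ← (((hrTs k).mul_left (hrTs k)).eq), mul_assoc]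
      rw [mul_assoc, ← hc.eq, ← mul_assoc, e, star_sub]
      noncomm_ring
    rw [Finset.sum_congr rfl fun k _ => h1 k, Finset.sum_add_distrib, Finset.sum_sub_distrib,
      Finset.sum_sub_distrib, ← Finset.sum_mul, ← Finset.sum_mul, ← Finset.mul_sum,
      ← Finset.sum_mul, hsum, ← hT, ← hTs]
    noncomm_ring
  have hle : star T * T ≤ m := by
    rw [← sub_nonneg, key]
    refine Finset.sum_nonneg fun k _ => ?_
    have hpos : 0 ≤ (m - star (b k) * b k) + star (b k - T) * (b k - T) := by
      refine add_nonneg ?_ (star_mul_self_nonneg _)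
      rw [sub_nonneg]
      refine (CStarAlgebra.star_mul_le_algebraMap_norm_sq (a := b k)).trans ?_
      exact algebraMap_mono D (pow_le_pow_left₀ (norm_nonneg _) (hb k) 2)
    have := star_left_conjugate_nonneg hpos (r k)
    rwa [hr] at this
  have := (CStarAlgebra.norm_le_iff_le_algebraMap (star T * T) (sq_nonneg M)
    (star_mul_self_nonneg T)).2 hle
  rw [CStarRing.norm_star_mul_self, ← sq] at this
  exact (pow_le_pow_iff_left₀ (norm_nonneg _) hM two_ne_zero).1 this

/-- The C*-algebra `C(S¹)` of continuous functions on the unit circle. -/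
abbrev CS1 : Type := C(Circle, ℂ)

variable {A D : Type} [CStarAlgebra A] [CStarAlgebra D]

/-- The `*`-homomorphism `f ↦ f(z) 1`. -/
def charHom (D : Type) [CStarAlgebra D] (z : Circle) : CS1 →⋆ₐ[ℂ] D :=
  (StarAlgHom.ofId ℂ D).comp (ContinuousMap.evalStarAlgHom ℂ ℂ z)

theorem charHom_apply (z : Circle) (f : CS1) : charHom D z f = algebraMap ℂ D (f z) := rfl

theorem charHom_commute (z : Circle) (f : CS1) (d : D) : Commute (charHom D z f) d :=
  Algebra.commutes (f z) d

/-- A finite partition of unity on the circle, made of squares, on whose members finitely many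
given functions are almost constant. -/
theorem exists_partition {n : ℕ} (f : Fin n → CS1) {ε : ℝ} (hε : 0 < ε) :
    ∃ (ι : Type) (_ : Fintype ι) (z : ι → Circle) (q : ι → CS1), (∀ k, star (q k) = q k) ∧
      ∑ k, q k * q k = 1 ∧ ∀ i, ‖f i - ∑ k, f i (z k) • (q k * q k)‖ ≤ ε := by
  let U : Circle → Set Circle := fun z => ⋂ i, {w | ‖f i w - f i z‖ < ε}
  have hU : ∀ z, IsOpen (U z) := fun z => isOpen_iInter_of_finite fun i =>
    isOpen_lt (by fun_prop) continuous_const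
  have hzU : ∀ z, z ∈ U z := fun z => by simp [U, hε]
  obtain ⟨t, ht⟩ := isCompact_univ.elim_finite_subcover U hU
    fun z _ => Set.mem_iUnion.2 ⟨z, hzU z⟩
  obtain ⟨p, hp⟩ := PartitionOfUnity.exists_isSubordinate_of_locallyFinite
    (s := (Set.univ : Set Circle)) isClosed_univ (fun z : t => U z) (fun z => hU z)
    (locallyFinite_of_finite _) (fun w hw => by
      obtain ⟨z, hz, hwz⟩ := Set.mem_iUnion₂.1 (ht hw)
      exact Set.mem_iUnion.2 ⟨⟨z, hz⟩, hwz⟩)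
  let q : t → CS1 := fun k => ⟨fun w => ((√(p k w) : ℝ) : ℂ), by fun_prop⟩
  have hqq : ∀ k w, q k w * q k w = ((p k w : ℝ) : ℂ) := fun k w => by
    show ((√(p k w) : ℝ) : ℂ) * ((√(p k w) : ℝ) : ℂ) = _
    rw [← Complex.ofReal_mul, Real.mul_self_sqrt (p.nonneg k w)]
  have hsum : ∀ w, ∑ k, p k w = 1 := fun w => by
    rw [← finsum_eq_sum_of_fintype]; exact p.sum_eq_one (Set.mem_univ w)
  refine ⟨t, inferInstance, fun k => k, q, fun k => ?_, ?_, fun i => ?_⟩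
  · ext w
    exact Complex.conj_ofReal _
  · ext w
    rw [ContinuousMap.sum_apply]
    simp only [ContinuousMap.mul_apply, hqq, ContinuousMap.one_apply]
    rw [← Complex.ofReal_sum, hsum, Complex.ofReal_one]
  · refine (ContinuousMap.norm_le _ hε.le).2 fun w => ?_
    have e : (f i - ∑ k : t, f i k • (q k * q k)) w =
        ∑ k : t, ((p k w : ℝ) : ℂ) * (f i w - f i k) := by
      rw [ContinuousMap.sub_apply, ContinuousMap.sum_apply]
      simp only [ContinuousMap.smul_apply, ContinuousMap.mul_apply, hqq, mul_sub,
        Finset.sum_sub_distrib, smul_eq_mul]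
      rw [← Finset.sum_mul, ← Complex.ofReal_sum, hsum, Complex.ofReal_one, one_mul]
      congr 1
      exact Finset.sum_congr rfl fun k _ => mul_comm _ _
    rw [e]
    calc ‖∑ k : t, ((p k w : ℝ) : ℂ) * (f i w - f i k)‖ ≤ ∑ k : t, p k w * ε := by
          refine norm_sum_le_of_le _ fun k _ => ?_
          rw [norm_mul, Complex.norm_real, Real.norm_of_nonneg (p.nonneg k w)]
          by_cases h0 : p k w = 0
          · rw [h0, zero_mul, zero_mul]
          · have hw : w ∈ U k := hp k (subset_tsupport _ h0)
            exact mul_le_mul_of_nonneg_left (Set.mem_iInter.1 hw i).le (p.nonneg k w)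
      _ = ε := by rw [← Finset.sum_mul, hsum, one_mul]

/-- The norm on `C(S¹) ⊗ A` is controlled by the evaluations at points of the circle. -/
theorem norm_algLift_le (φ : CS1 →⋆ₐ[ℂ] D) (ψ : A →⋆ₐ[ℂ] D) (h : ∀ f a, Commute (φ f) (ψ a))
    (x : CS1 ⊗[ℂ] A) {M : ℝ}
    (hM : ∀ z, ‖algLift (charHom D z) ψ (fun f a => charHom_commute z f (ψ a)) x‖ ≤ M) :
    ‖algLift φ ψ h x‖ ≤ M := by
  have hM0 : 0 ≤ M := (norm_nonneg _).trans (hM 1)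
  obtain ⟨n, f, a, rfl⟩ := TensorProduct.exists_sum_tmul_eq x
  have hx : ∀ z, algLift (charHom D z) ψ (fun f a => charHom_commute z f (ψ a))
      (∑ i, f i ⊗ₜ[ℂ] a i) = ∑ i, f i z • ψ (a i) := fun z => by
    rw [map_sum]
    refine Finset.sum_congr rfl fun i _ => ?_
    rw [algLift_tmul, charHom_apply, Algebra.smul_def]
  have hφ : algLift φ ψ h (∑ i, f i ⊗ₜ[ℂ] a i) = ∑ i, φ (f i) * ψ (a i) := by
    rw [map_sum]
    exact Finset.sum_congr rfl fun i _ => algLift_tmul _ _ _ _ _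
  rw [hφ]
  refine le_of_forall_pos_le_add fun δ hδ => ?_
  set C : ℝ := ∑ i, ‖ψ (a i)‖ with hC
  have hC0 : 0 ≤ C := Finset.sum_nonneg fun _ _ => norm_nonneg _
  have hε : 0 < δ / (C + 1) := by positivity
  obtain ⟨ι, _, z, q, hq, hq1, hqf⟩ := exists_partition f hε
  let b : ι → D := fun k => ∑ i, f i (z k) • ψ (a i)
  have hb : ∀ k, ‖b k‖ ≤ M := fun k => (congrArg norm (hx (z k))).symm.trans_le (hM (z k))
  have hconv : ‖∑ k, φ (q k) * φ (q k) * b k‖ ≤ M := by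
    refine norm_convex_le (fun k => φ (q k)) b (fun k => ?_) (fun j k => ?_) (fun j k => ?_) ?_
      hM0 hb
    · rw [← map_star, hq]
    · exact (Commute.all (q j) (q k)).map φ
    · exact Commute.sum_right _ _ _ fun i _ => (h (q j) (a i)).smul_right _
    · rw [← map_one φ, ← hq1, map_sum]
      exact Finset.sum_congr rfl fun k _ => (map_mul φ _ _).symm
  have hdiff : ∑ i, φ (f i) * ψ (a i) = ∑ k, φ (q k) * φ (q k) * b k +
      ∑ i, φ (f i - ∑ k, f i (z k) • (q k * q k)) * ψ (a i) := by
    have : ∑ k, φ (q k) * φ (q k) * b k =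
        ∑ i, φ (∑ k, f i (z k) • (q k * q k)) * ψ (a i) := by
      simp only [b, Finset.mul_sum]
      rw [Finset.sum_comm]
      refine Finset.sum_congr rfl fun i _ => ?_
      rw [map_sum, Finset.sum_mul]
      refine Finset.sum_congr rfl fun k _ => ?_
      rw [map_smul, map_mul, mul_smul_comm, smul_mul_assoc]
    rw [this, ← Finset.sum_add_distrib]
    refine Finset.sum_congr rfl fun i _ => ?_
    rw [← add_mul, ← map_add, add_sub_cancel]
  rw [hdiff]
  refine (norm_add_le _ _).trans (add_le_add hconv ?_)
  calc ‖∑ i, φ (f i - ∑ k, f i (z k) • (q k * q k)) * ψ (a i)‖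
      ≤ ∑ i, δ / (C + 1) * ‖ψ (a i)‖ := by
        refine norm_sum_le_of_le _ fun i _ => (norm_mul_le _ _).trans ?_
        refine mul_le_mul_of_nonneg_right ?_ (norm_nonneg _)
        exact (NonUnitalStarAlgHom.norm_apply_le φ _).trans (hqf i)
    _ = δ * (C / (C + 1)) := by rw [← Finset.mul_sum, ← hC]; ring
    _ ≤ δ := mul_le_of_le_one_right hδ.le ((div_le_one (by positivity)).2 (by linarith))

namespace MinTensor

variable {A' B' : Type} [CStarAlgebra A'] [CStarAlgebra B']

/-- The extension of `π ⊗ ρ` to the minimal tensor product. -/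
def rep (π : HilbertRep A') (ρ : HilbertRep B') :
    MinTensor A' B' →⋆ₐ[ℂ] BOp (HilbertTensor π.space ρ.space) :=
  lift (pairRep π ρ) (norm_pairRep_le π ρ)

theorem norm_le_of_rep {d : MinTensor A' B'} {C : ℝ}
    (h : ∀ (π : HilbertRep A') (ρ : HilbertRep B'), ‖rep π ρ d‖ ≤ C) : ‖d‖ ≤ C := by
  refine le_of_forall_pos_le_add fun ε hε => ?_
  obtain ⟨x, hx⟩ := (tensorFamily A' B').denseRange_of.exists_dist_lt d (half_pos hε)
  change dist d (of A' B' x) < ε / 2 at hx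
  rw [dist_eq_norm] at hx
  have h1 : ‖of A' B' x‖ ≤ C + ε / 2 := norm_of_le fun π ρ => by
    have e : pairRep π ρ x = rep π ρ d - rep π ρ (d - of A' B' x) := by
      rw [map_sub, sub_sub_cancel]
      exact (lift_of _ _ _).symm
    rw [e]
    refine (norm_sub_le _ _).trans (add_le_add (h π ρ) ?_)
    exact (NonUnitalStarAlgHom.norm_apply_le (rep π ρ) _).trans hx.le
  calc ‖d‖ = ‖(d - of A' B' x) + of A' B' x‖ := by rw [sub_add_cancel]
    _ ≤ ‖d - of A' B' x‖ + ‖of A' B' x‖ := norm_add_le _ _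
    _ ≤ C + ε := by linarith

/-- Evaluation at a point of the circle, as a representation on `ℂ`. -/
def _root_.QuantumPlane.charRep (z : Circle) : HilbertRep CS1 where
  space := ℂ
  π := charHom (BOp ℂ) z

theorem _root_.QuantumPlane.opRight_injective (H : Type) [NormedAddCommGroup H]
    [InnerProductSpace ℂ H] [CompleteSpace H] : Function.Injective (opRight ℂ H) := by
  suffices h : ∀ T : H →L[ℂ] H, opTensor (1 : ℂ →L[ℂ] ℂ) T = 0 → T = 0 from
    (injective_iff_map_eq_zero _).2 fun T hT => h T hT
  intro T hT
  ext y
  have h1 : opTensor (1 : ℂ →L[ℂ] ℂ) T ((1 ⊗ₜ[ℂ] y : ℂ ⊗[ℂ] H) : HilbertTensor ℂ H) = 0 := by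
    rw [hT]; rfl
  rw [opTensor_tmul] at h1
  have h2 := congrArg norm h1
  rw [Completion.norm_coe, TensorProduct.norm_tmul, norm_zero] at h2
  simpa using h2

theorem norm_eval_le (ψ : A →⋆ₐ[ℂ] MinTensor A' B') (z : Circle) (x : CS1 ⊗[ℂ] A) :
    ‖algLift (charHom (MinTensor A' B') z) ψ (fun f a => charHom_commute z f (ψ a)) x‖ ≤
      ‖of CS1 A x‖ := by
  refine norm_le_of_rep fun π ρ => ?_
  let σ : HilbertRep A :=
    { space := HilbertTensor π.space ρ.space
      π := (rep π ρ).comp ψ }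
  have key : opRight ℂ (HilbertTensor π.space ρ.space)
      (rep π ρ (algLift (charHom (MinTensor A' B') z) ψ
        (fun f a => charHom_commute z f (ψ a)) x)) = pairRep (charRep z) σ x := by
    induction x using TensorProduct.induction_on with
    | zero => rw [map_zero, map_zero, map_zero, map_zero]; rfl
    | add x y hx hy => rw [map_add, map_add, map_add, map_add, hx, hy]; rfl
    | tmul f a =>
      rw [algLift_tmul, pairRep_tmul, map_mul, map_mul, charHom_apply, Algebra.algebraMap_eq_smul_one,
        map_smul, map_smul, map_one, map_one]
      have : (charRep z).π f = f z • 1 := by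
        rw [← Algebra.algebraMap_eq_smul_one]; rfl
      rw [this, map_smul, map_one]
      rfl
  rw [← NonUnitalStarAlgHom.norm_map _ (opRight_injective (HilbertTensor π.space ρ.space)), key]
  exact norm_pairRep_le (charRep z) σ x

/-- Two `*`-homomorphisms `φ` and `ψ` with commuting ranges define a `*`-homomorphism on
`C(S¹) ⊗ A` by `v ⊗ a ↦ φ(v) ψ(a)`. -/
def circleLift (φ : CS1 →⋆ₐ[ℂ] MinTensor A' B') (ψ : A →⋆ₐ[ℂ] MinTensor A' B')
    (h : ∀ f a, Commute (φ f) (ψ a)) : MinTensor CS1 A →⋆ₐ[ℂ] MinTensor A' B' :=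
  lift (algLift φ ψ h) fun x => norm_algLift_le φ ψ h x fun z => norm_eval_le ψ z x

theorem circleLift_tmul (φ : CS1 →⋆ₐ[ℂ] MinTensor A' B') (ψ : A →⋆ₐ[ℂ] MinTensor A' B')
    (h : ∀ f a, Commute (φ f) (ψ a)) (f : CS1) (a : A) :
    circleLift φ ψ h (tmul f a) = φ f * ψ a := by
  rw [circleLift, tmul, lift_of, algLift_tmul]

theorem induction {p : MinTensor A' B' → Prop} (a : MinTensor A' B') (hp : IsClosed {a | p a})
    (h : ∀ x, p (of A' B' x)) : p a := (tensorFamily A' B').induction_of a hp h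

/-- Elementary tensors `1 ⊗ f` with `f ∈ C(S¹)` are central in `A ⊗ C(S¹)`. -/
theorem commute_inr (f : CS1) (x : MinTensor A CS1) : Commute (inr A CS1 f) x := by
  refine MinTensor.induction (p := fun x => Commute (inr A CS1 f) x) x
    (isClosed_eq (by fun_prop) (by fun_prop)) fun x => ?_
  induction x using TensorProduct.induction_on with
  | zero => rw [map_zero]; exact Commute.zero_right _
  | add x y hx hy => rw [map_add]; exact hx.add_right hy
  | tmul a g =>
    show tmul 1 f * tmul a g = tmul a g * tmul 1 f
    rw [tmul_mul, tmul_mul, mul_comm f g, one_mul, mul_one]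

section swap

variable {B : Type} [CStarAlgebra B]

/-- The flip of the factors of a Hilbert space tensor product. -/
def hilbertFlip (H K : Type) [NormedAddCommGroup H] [InnerProductSpace ℂ H]
    [NormedAddCommGroup K] [InnerProductSpace ℂ K] : HilbertTensor H K →L[ℂ] HilbertTensor K H :=
  (TensorProduct.commIsometry ℂ H K).toContinuousLinearEquiv.toContinuousLinearMap.completion

section flip

variable {H K : Type} [NormedAddCommGroup H] [InnerProductSpace ℂ H] [CompleteSpace H]
  [NormedAddCommGroup K] [InnerProductSpace ℂ K] [CompleteSpace K]

set_option linter.unusedSectionVars false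

theorem hilbertFlip_coe (z : H ⊗[ℂ] K) :
    hilbertFlip H K z = ((TensorProduct.comm ℂ H K z : K ⊗[ℂ] H) : HilbertTensor K H) :=
  ContinuousLinearMap.completion_apply_coe _ _

theorem norm_hilbertFlip (ξ : HilbertTensor H K) : ‖hilbertFlip H K ξ‖ = ‖ξ‖ := by
  induction ξ using Completion.induction_on with
  | hp => exact isClosed_eq (by fun_prop) (by fun_prop)
  | ih z => rw [hilbertFlip_coe, Completion.norm_coe, Completion.norm_coe, TensorProduct.norm_comm]

theorem hilbertFlip_flip (ξ : HilbertTensor H K) : hilbertFlip K H (hilbertFlip H K ξ) = ξ := by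
  induction ξ using Completion.induction_on with
  | hp => exact isClosed_eq (by fun_prop) (by fun_prop)
  | ih z => rw [hilbertFlip_coe, hilbertFlip_coe, TensorProduct.comm_comm]

theorem opTensor_flip (S : H →L[ℂ] H) (T : K →L[ℂ] K) (ξ : HilbertTensor H K) :
    opTensor T S (hilbertFlip H K ξ) = hilbertFlip H K (opTensor S T ξ) := by
  induction ξ using Completion.induction_on with
  | hp => exact isClosed_eq (by fun_prop) (by fun_prop)
  | ih z =>
    induction z using TensorProduct.induction_on with
    | zero => simp only [Completion.coe_zero, map_zero]
    | add x y hx hy => simp only [Completion.coe_add, map_add, hx, hy]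
    | tmul x y =>
      rw [opTensor_tmul, hilbertFlip_coe, hilbertFlip_coe, TensorProduct.comm_tmul,
        TensorProduct.comm_tmul, opTensor_tmul]

end flip

/-- A bounded operator on a Hilbert space, as a map. -/
def _root_.QuantumPlane.BOp.app {H : Type} [NormedAddCommGroup H] [InnerProductSpace ℂ H]
    [CompleteSpace H] (T : BOp H) : H →L[ℂ] H := T

theorem pairRep_flip (π : HilbertRep B) (ρ : HilbertRep A) (x : A ⊗[ℂ] B)
    (ξ : HilbertTensor ρ.space π.space) :
    (rep π ρ (algLift (inr B A) (inl B A) (fun a b => (commute_inl_inr b a).symm) x)).app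
      (hilbertFlip _ _ ξ) = hilbertFlip _ _ ((pairRep ρ π x).app ξ) := by
  induction x using TensorProduct.induction_on with
  | zero =>
    rw [map_zero, map_zero, map_zero]
    exact (map_zero (hilbertFlip ρ.space π.space)).symm
  | add x y hx hy =>
    rw [map_add, map_add, map_add]
    exact (congrArg₂ (· + ·) hx hy).trans (map_add (hilbertFlip ρ.space π.space) _ _).symm
  | tmul a b =>
    rw [algLift_tmul, inr_mul_inl, tmul, rep, lift_of, pairRep_tmul, pairRep_tmul,
      opLeft_mul_opRight, opLeft_mul_opRight]
    exact opTensor_flip _ _ ξ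

theorem norm_algSwap_le (x : A ⊗[ℂ] B) :
    ‖algLift (inr B A) (inl B A) (fun a b => (commute_inl_inr b a).symm) x‖ ≤ ‖of A B x‖ := by
  refine norm_le_of_rep fun π ρ => le_trans ?_ (norm_pairRep_le ρ π x)
  refine ContinuousLinearMap.opNorm_le_bound
    (rep π ρ (algLift (inr B A) (inl B A) (fun a b => (commute_inl_inr b a).symm) x)).app
    (norm_nonneg _) fun ζ => ?_
  have h1 := pairRep_flip π ρ x (hilbertFlip _ _ ζ)
  rw [hilbertFlip_flip] at h1
  rw [h1, norm_hilbertFlip]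
  refine (ContinuousLinearMap.le_opNorm (pairRep ρ π x).app _).trans_eq ?_
  rw [norm_hilbertFlip]
  rfl

variable (A B) in
/-- The flip `a ⊗ b ↦ b ⊗ a`. -/
def swap : MinTensor A B →⋆ₐ[ℂ] MinTensor B A :=
  lift (algLift (inr B A) (inl B A) (fun a b => (commute_inl_inr b a).symm)) norm_algSwap_le

theorem swap_tmul (a : A) (b : B) : swap A B (tmul a b) = tmul b a := by
  rw [swap, tmul, lift_of, algLift_tmul, inr_mul_inl]

end swap

end MinTensor

end Nuclear

/-! ## The circle group and the Toeplitz algebra -/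

namespace CS1

/-- The generating unitary: the inclusion of the circle in `ℂ`. -/
def u : CS1 := ⟨fun z => (z : ℂ), by fun_prop⟩

theorem star_u_mul_u : star u * u = 1 := by
  ext z
  show conj (z : ℂ) * (z : ℂ) = 1
  rw [← Complex.normSq_eq_conj_mul_self, Circle.normSq_coe, Complex.ofReal_one]

/-- The antipode: `S(f)(z) = f(z⁻¹)`. -/
def antipode : CS1 →⋆ₐ[ℂ] CS1 :=
  ContinuousMap.compStarAlgHom' ℂ ℂ (⟨fun z => z⁻¹, by fun_prop⟩ : C(Circle, Circle))

theorem antipode_apply (f : CS1) (z : Circle) : antipode f z = f z⁻¹ := rfl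

/-- The action of the circle group by translations, `(rot g f)(z) = f(z g)`. -/
def rot (g : Circle) : CS1 →⋆ₐ[ℂ] CS1 :=
  ContinuousMap.compStarAlgHom' ℂ ℂ (⟨fun z => z * g, by fun_prop⟩ : C(Circle, Circle))

theorem rot_apply (g : Circle) (f : CS1) (z : Circle) : rot g f z = f (z * g) := rfl

theorem rot_one : rot 1 = StarAlgHom.id ℂ CS1 := by
  ext f z; show f (z * 1) = f z; rw [mul_one]

theorem rot_mul (g h : Circle) : rot (g * h) = (rot g).comp (rot h) := by
  ext f z; show f (z * (g * h)) = f (z * g * h); rw [mul_assoc]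

end CS1

namespace Toeplitz

/-- The symbol map `σ : 𝒯 → C(S¹)`, `s ↦ u`. -/
def symbol : Toeplitz →⋆ₐ[ℂ] CS1 := lift CS1.u CS1.star_u_mul_u

theorem circle_smul_isometry (g : Circle) : star ((g : ℂ) • s) * ((g : ℂ) • s) = 1 := by
  rw [star_smul, smul_mul_smul_comm, star_s_mul_s]
  have : star (g : ℂ) * (g : ℂ) = 1 := by
    show conj (g : ℂ) * (g : ℂ) = 1
    rw [← Complex.normSq_eq_conj_mul_self, Circle.normSq_coe, Complex.ofReal_one]
  rw [this, one_smul]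

/-- The gauge action of `g ∈ U(1)` on the Toeplitz algebra, `s ↦ g s`. -/
def gauge (g : Circle) : Toeplitz →⋆ₐ[ℂ] Toeplitz := lift ((g : ℂ) • s) (circle_smul_isometry g)

theorem gauge_s (g : Circle) : gauge g s = (g : ℂ) • s := lift_s _ _

theorem gauge_one : gauge 1 = StarAlgHom.id ℂ Toeplitz :=
  hom_ext <| by rw [gauge_s, Circle.coe_one, one_smul]; rfl

theorem gauge_mul (g h : Circle) : gauge (g * h) = (gauge g).comp (gauge h) :=
  hom_ext <| by
    rw [StarAlgHom.comp_apply, gauge_s, gauge_s, map_smul, gauge_s, smul_smul, Circle.coe_mul,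
      mul_comm]

theorem symbol_gauge (g : Circle) : symbol.comp (gauge g) = (CS1.rot g).comp symbol :=
  hom_ext <| by
    rw [StarAlgHom.comp_apply, StarAlgHom.comp_apply, gauge_s, map_smul, symbol, lift_s]
    ext z
    show (g : ℂ) * (z : ℂ) = ((z * g : Circle) : ℂ)
    rw [Circle.coe_mul, mul_comm]

/-- The gauge coaction `δ : 𝒯 → 𝒯 ⊗ C(U(1))`, `s ↦ s ⊗ u`. -/
def coaction : Toeplitz →⋆ₐ[ℂ] MinTensor Toeplitz CS1 :=
  lift (MinTensor.tmul s CS1.u) <| by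
    rw [MinTensor.star_tmul, MinTensor.tmul_mul, star_s_mul_s, CS1.star_u_mul_u,
      MinTensor.one_def]

theorem coaction_s : coaction s = MinTensor.tmul s CS1.u := lift_s _ _

end Toeplitz

/-! ## Triple pullbacks, actions and fixed points -/

/-- The triple-pullback C*-algebra: all triples `(b₀, b₁, b₂)` with `π⁰₁(b₀) = π¹₀(b₁)`,
`π⁰₂(b₀) = π²₀(b₂)` and `π¹₂(b₁) = π²₁(b₂)`. -/
def triplePullback {B₀ B₁ B₂ B₀₁ B₀₂ B₁₂ : Type} [CStarAlgebra B₀] [CStarAlgebra B₁]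
    [CStarAlgebra B₂] [CStarAlgebra B₀₁] [CStarAlgebra B₀₂] [CStarAlgebra B₁₂]
    (π₀₁ : B₀ →⋆ₐ[ℂ] B₀₁) (π₁₀ : B₁ →⋆ₐ[ℂ] B₀₁) (π₀₂ : B₀ →⋆ₐ[ℂ] B₀₂) (π₂₀ : B₂ →⋆ₐ[ℂ] B₀₂)
    (π₁₂ : B₁ →⋆ₐ[ℂ] B₁₂) (π₂₁ : B₂ →⋆ₐ[ℂ] B₁₂) : StarSubalgebra ℂ (B₀ × B₁ × B₂) where
  carrier := {b | π₀₁ b.1 = π₁₀ b.2.1 ∧ π₀₂ b.1 = π₂₀ b.2.2 ∧ π₁₂ b.2.1 = π₂₁ b.2.2}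
  mul_mem' := by
    rintro a b ⟨h1, h2, h3⟩ ⟨h1', h2', h3'⟩
    refine ⟨?_, ?_, ?_⟩
    · rw [Prod.fst_mul, Prod.snd_mul, Prod.fst_mul, map_mul, map_mul, h1, h1']
    · rw [Prod.fst_mul, Prod.snd_mul, Prod.snd_mul, map_mul, map_mul, h2, h2']
    · rw [Prod.snd_mul, Prod.fst_mul, Prod.snd_mul, map_mul, map_mul, h3, h3']
  add_mem' := by
    rintro a b ⟨h1, h2, h3⟩ ⟨h1', h2', h3'⟩
    refine ⟨?_, ?_, ?_⟩
    · rw [Prod.fst_add, Prod.snd_add, Prod.fst_add, map_add, map_add, h1, h1']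
    · rw [Prod.fst_add, Prod.snd_add, Prod.snd_add, map_add, map_add, h2, h2']
    · rw [Prod.snd_add, Prod.fst_add, Prod.snd_add, map_add, map_add, h3, h3']
  algebraMap_mem' c :=
    ⟨(AlgHomClass.commutes π₀₁ c).trans (AlgHomClass.commutes π₁₀ c).symm,
      (AlgHomClass.commutes π₀₂ c).trans (AlgHomClass.commutes π₂₀ c).symm,
      (AlgHomClass.commutes π₁₂ c).trans (AlgHomClass.commutes π₂₁ c).symm⟩
  star_mem' := by
    rintro a ⟨h1, h2, h3⟩
    refine ⟨?_, ?_, ?_⟩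
    · rw [Prod.fst_star, Prod.snd_star, Prod.fst_star, map_star, map_star, h1]
    · rw [Prod.fst_star, Prod.snd_star, Prod.snd_star, map_star, map_star, h2]
    · rw [Prod.snd_star, Prod.fst_star, Prod.snd_star, map_star, map_star, h3]

/-- A triple pullback is norm closed, hence a C*-algebra. -/
theorem isClosed_triplePullback {B₀ B₁ B₂ B₀₁ B₀₂ B₁₂ : Type} [CStarAlgebra B₀] [CStarAlgebra B₁]
    [CStarAlgebra B₂] [CStarAlgebra B₀₁] [CStarAlgebra B₀₂] [CStarAlgebra B₁₂]
    (π₀₁ : B₀ →⋆ₐ[ℂ] B₀₁) (π₁₀ : B₁ →⋆ₐ[ℂ] B₀₁) (π₀₂ : B₀ →⋆ₐ[ℂ] B₀₂) (π₂₀ : B₂ →⋆ₐ[ℂ] B₀₂)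
    (π₁₂ : B₁ →⋆ₐ[ℂ] B₁₂) (π₂₁ : B₂ →⋆ₐ[ℂ] B₁₂) :
    IsClosed (triplePullback π₀₁ π₁₀ π₀₂ π₂₀ π₁₂ π₂₁ : Set (B₀ × B₁ × B₂)) := by
  have h {A B : Type} [CStarAlgebra A] [CStarAlgebra B] (f : A →⋆ₐ[ℂ] B) : Continuous f :=
    NonUnitalStarAlgHom.instContinuousLinearMapClassComplex.map_continuous f
  have f01 := h π₀₁; have f10 := h π₁₀; have f02 := h π₀₂
  have f20 := h π₂₀; have f12 := h π₁₂; have f21 := h π₂₁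
  exact (isClosed_eq (by fun_prop) (by fun_prop)).inter
    ((isClosed_eq (by fun_prop) (by fun_prop)).inter (isClosed_eq (by fun_prop) (by fun_prop)))

/-- The fixed-point subalgebra of an action by `*`-automorphisms. -/
def fixedPointSubalgebra {G A : Type*} [Group G] [Ring A] [StarRing A] [Algebra ℂ A]
    [StarModule ℂ A] (α : G →* (A ≃⋆ₐ[ℂ] A)) : StarSubalgebra ℂ A where
  carrier := {a | ∀ g, α g a = a}
  mul_mem' ha hb g := by rw [map_mul, ha g, hb g]
  add_mem' ha hb g := by rw [map_add, ha g, hb g]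
  algebraMap_mem' c g := AlgHomClass.commutes (α g) c
  star_mem' ha g := by rw [map_star, ha g]

/-! ## The quantum sphere `S⁵_H` -/

namespace Sphere

open MinTensor Toeplitz

/-- The identity of the Toeplitz algebra. -/
abbrev idT : Toeplitz →⋆ₐ[ℂ] Toeplitz := StarAlgHom.id ℂ Toeplitz
/-- The identity of `C(S¹)`. -/
abbrev idC : CS1 →⋆ₐ[ℂ] CS1 := StarAlgHom.id ℂ CS1

/-- `C(S¹) ⊗ 𝒯 ⊗ 𝒯`. -/
abbrev B₀ : Type := MinTensor (MinTensor CS1 Toeplitz) Toeplitz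
/-- `𝒯 ⊗ C(S¹) ⊗ 𝒯`. -/
abbrev B₁ : Type := MinTensor (MinTensor Toeplitz CS1) Toeplitz
/-- `𝒯 ⊗ 𝒯 ⊗ C(S¹)`. -/
abbrev B₂ : Type := MinTensor (MinTensor Toeplitz Toeplitz) CS1
/-- `C(S¹) ⊗ C(S¹) ⊗ 𝒯`. -/
abbrev B₀₁ : Type := MinTensor (MinTensor CS1 CS1) Toeplitz
/-- `C(S¹) ⊗ 𝒯 ⊗ C(S¹)`. -/
abbrev B₀₂ : Type := MinTensor (MinTensor CS1 Toeplitz) CS1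
/-- `𝒯 ⊗ C(S¹) ⊗ C(S¹)`. -/
abbrev B₁₂ : Type := MinTensor (MinTensor Toeplitz CS1) CS1

/-- `id ⊗ σ ⊗ id`; the six structure maps are the symbol map on one factor and the identity on the
others. -/
def π₀₁ : B₀ →⋆ₐ[ℂ] B₀₁ := map (map idC symbol) idT
/-- `σ ⊗ id ⊗ id`. -/
def π₁₀ : B₁ →⋆ₐ[ℂ] B₀₁ := map (map symbol idC) idT
/-- `id ⊗ id ⊗ σ`. -/
def π₀₂ : B₀ →⋆ₐ[ℂ] B₀₂ := map (map idC idT) symbol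
/-- `σ ⊗ id ⊗ id`. -/
def π₂₀ : B₂ →⋆ₐ[ℂ] B₀₂ := map (map symbol idT) idC
/-- `id ⊗ id ⊗ σ`. -/
def π₁₂ : B₁ →⋆ₐ[ℂ] B₁₂ := map (map idT idC) symbol
/-- `id ⊗ σ ⊗ id`. -/
def π₂₁ : B₂ →⋆ₐ[ℂ] B₁₂ := map (map idT symbol) idC

/-- The C*-algebra `C(S⁵_H)` of the Heegaard odd quantum sphere. -/
def C : StarSubalgebra ℂ (B₀ × B₁ × B₂) := triplePullback π₀₁ π₁₀ π₀₂ π₂₀ π₁₂ π₂₁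

/-- The diagonal action of `g ∈ U(1)` on `C(S¹) ⊗ 𝒯 ⊗ 𝒯`: the gauge action on each factor `𝒯` and
the translation action on each factor `C(S¹)`. -/
def act₀ (g : Circle) : B₀ →⋆ₐ[ℂ] B₀ := map (map (CS1.rot g) (gauge g)) (gauge g)
/-- The diagonal action on `𝒯 ⊗ C(S¹) ⊗ 𝒯`. -/
def act₁ (g : Circle) : B₁ →⋆ₐ[ℂ] B₁ := map (map (gauge g) (CS1.rot g)) (gauge g)
/-- The diagonal action on `𝒯 ⊗ 𝒯 ⊗ C(S¹)`. -/
def act₂ (g : Circle) : B₂ →⋆ₐ[ℂ] B₂ := map (map (gauge g) (gauge g)) (CS1.rot g)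

theorem act₀_one (x : B₀) : act₀ 1 x = x := by
  rw [act₀, CS1.rot_one, gauge_one, map_id, map_id]; rfl
theorem act₁_one (x : B₁) : act₁ 1 x = x := by
  rw [act₁, CS1.rot_one, gauge_one, map_id, map_id]; rfl
theorem act₂_one (x : B₂) : act₂ 1 x = x := by
  rw [act₂, CS1.rot_one, gauge_one, map_id, map_id]; rfl

theorem act₀_mul (g h : Circle) (x : B₀) : act₀ (g * h) x = act₀ g (act₀ h x) := by
  rw [act₀, CS1.rot_mul, gauge_mul, ← map_comp, ← map_comp]; rfl
theorem act₁_mul (g h : Circle) (x : B₁) : act₁ (g * h) x = act₁ g (act₁ h x) := by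
  rw [act₁, CS1.rot_mul, gauge_mul, ← map_comp, ← map_comp]; rfl
theorem act₂_mul (g h : Circle) (x : B₂) : act₂ (g * h) x = act₂ g (act₂ h x) := by
  rw [act₂, CS1.rot_mul, gauge_mul, ← map_comp, ← map_comp]; rfl

/-- The diagonal action of `g` on the product of the three algebras. -/
def actProd (g : Circle) : (B₀ × B₁ × B₂) →⋆ₐ[ℂ] (B₀ × B₁ × B₂) :=
  ((act₀ g).comp (StarAlgHom.fst ℂ B₀ (B₁ × B₂))).prod
    (((act₁ g).comp ((StarAlgHom.fst ℂ B₁ B₂).comp (StarAlgHom.snd ℂ B₀ (B₁ × B₂)))).prod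
      ((act₂ g).comp ((StarAlgHom.snd ℂ B₁ B₂).comp (StarAlgHom.snd ℂ B₀ (B₁ × B₂)))))

theorem actProd_apply (g : Circle) (b : B₀ × B₁ × B₂) :
    actProd g b = (act₀ g b.1, act₁ g b.2.1, act₂ g b.2.2) := rfl

/-- The diagonal action preserves the triple pullback. -/
theorem actProd_mem (g : Circle) {b : B₀ × B₁ × B₂} (hb : b ∈ C) : actProd g b ∈ C := by
  obtain ⟨h1, h2, h3⟩ := hb
  have hC : idC.comp (CS1.rot g) = (CS1.rot g).comp idC := rfl
  have hT : idT.comp (gauge g) = (gauge g).comp idT := rfl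
  have hS := symbol_gauge g
  have e01 : π₀₁.comp (act₀ g) = (map (map (CS1.rot g) (CS1.rot g)) (gauge g)).comp π₀₁ := by
    rw [π₀₁, act₀, map_comp, map_comp, map_comp, map_comp, hC, hT, hS]
  have e10 : π₁₀.comp (act₁ g) = (map (map (CS1.rot g) (CS1.rot g)) (gauge g)).comp π₁₀ := by
    rw [π₁₀, act₁, map_comp, map_comp, map_comp, map_comp, hC, hT, hS]
  have e02 : π₀₂.comp (act₀ g) = (map (map (CS1.rot g) (gauge g)) (CS1.rot g)).comp π₀₂ := by
    rw [π₀₂, act₀, map_comp, map_comp, map_comp, map_comp, hC, hT, hS]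
  have e20 : π₂₀.comp (act₂ g) = (map (map (CS1.rot g) (gauge g)) (CS1.rot g)).comp π₂₀ := by
    rw [π₂₀, act₂, map_comp, map_comp, map_comp, map_comp, hC, hT, hS]
  have e12 : π₁₂.comp (act₁ g) = (map (map (gauge g) (CS1.rot g)) (CS1.rot g)).comp π₁₂ := by
    rw [π₁₂, act₁, map_comp, map_comp, map_comp, map_comp, hC, hT, hS]
  have e21 : π₂₁.comp (act₂ g) = (map (map (gauge g) (CS1.rot g)) (CS1.rot g)).comp π₂₁ := by
    rw [π₂₁, act₂, map_comp, map_comp, map_comp, map_comp, hC, hT, hS]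
  refine ⟨?_, ?_, ?_⟩
  · refine (DFunLike.congr_fun e01 b.1).trans (Eq.trans ?_ (DFunLike.congr_fun e10 b.2.1).symm)
    exact congrArg _ h1
  · refine (DFunLike.congr_fun e02 b.1).trans (Eq.trans ?_ (DFunLike.congr_fun e20 b.2.2).symm)
    exact congrArg _ h2
  · refine (DFunLike.congr_fun e12 b.2.1).trans (Eq.trans ?_ (DFunLike.congr_fun e21 b.2.2).symm)
    exact congrArg _ h3

theorem actProd_one (b : B₀ × B₁ × B₂) : actProd 1 b = b := by
  rw [actProd_apply, act₀_one, act₁_one, act₂_one]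

theorem actProd_mul (g h : Circle) (b : B₀ × B₁ × B₂) :
    actProd (g * h) b = actProd g (actProd h b) := by
  rw [actProd_apply, act₀_mul, act₁_mul, act₂_mul]; rfl

/-- The diagonal `U(1)`-action on `C(S⁵_H)`. -/
def diagonalAction : Circle →* (C ≃⋆ₐ[ℂ] C) where
  toFun g :=
    { toFun := fun b => ⟨actProd g b, actProd_mem g b.2⟩
      invFun := fun b => ⟨actProd g⁻¹ b, actProd_mem g⁻¹ b.2⟩
      left_inv := fun b => Subtype.ext <| by
        show actProd g⁻¹ (actProd g b) = b
        rw [← actProd_mul, inv_mul_cancel, actProd_one]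
      right_inv := fun b => Subtype.ext <| by
        show actProd g (actProd g⁻¹ b) = b
        rw [← actProd_mul, mul_inv_cancel, actProd_one]
      map_mul' := fun a b => Subtype.ext <| map_mul (actProd g) (a : B₀ × B₁ × B₂) b
      map_add' := fun a b => Subtype.ext <| map_add (actProd g) (a : B₀ × B₁ × B₂) b
      map_star' := fun a => Subtype.ext <| map_star (actProd g) (a : B₀ × B₁ × B₂)
      map_smul' := fun c a => Subtype.ext <| map_smul (actProd g) c (a : B₀ × B₁ × B₂) }
  map_one' := StarAlgEquiv.ext fun b => Subtype.ext <| actProd_one _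
  map_mul' g h := StarAlgEquiv.ext fun b => Subtype.ext <| actProd_mul g h _

end Sphere

/-! ## The quantum projective plane `ℂP²_𝒯` -/

namespace ProjectivePlane

open MinTensor Toeplitz

/-- `𝒯 ⊗ 𝒯`. -/
abbrev TT : Type := MinTensor Toeplitz Toeplitz
/-- `C(S¹) ⊗ 𝒯`. -/
abbrev CT : Type := MinTensor CS1 Toeplitz
/-- `𝒯 ⊗ C(S¹)`. -/
abbrev TC : Type := MinTensor Toeplitz CS1

/-- The symbol map on the first factor. -/
def σ₁ : TT →⋆ₐ[ℂ] CT := map symbol (StarAlgHom.id ℂ Toeplitz)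
/-- The symbol map on the second factor. -/
def σ₂ : TT →⋆ₐ[ℂ] TC := map (StarAlgHom.id ℂ Toeplitz) symbol

/-- The homomorphism `C(S¹) ⊗ 𝒯 → 𝒯 ⊗ C(S¹)`, `v ⊗ t ↦ t₍₀₎ ⊗ t₍₁₎ v`. -/
def twist : CT →⋆ₐ[ℂ] TC := circleLift (inr Toeplitz CS1) coaction fun f _ => commute_inr f _

theorem twist_tmul (v : CS1) (t : Toeplitz) : twist (tmul v t) = coaction t * tmul 1 v := by
  rw [twist, circleLift_tmul, (commute_inr v _).eq]; rfl

/-- `Ψ₀₂(v ⊗ t) = t₍₀₎ ⊗ S(t₍₁₎ v)`. -/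
def Ψ₀₂ : CT →⋆ₐ[ℂ] TC := (map (StarAlgHom.id ℂ Toeplitz) CS1.antipode).comp twist

theorem Ψ₀₂_tmul (v : CS1) (t : Toeplitz) :
    Ψ₀₂ (tmul v t) = map (StarAlgHom.id ℂ Toeplitz) CS1.antipode (coaction t * tmul 1 v) := by
  rw [Ψ₀₂, StarAlgHom.comp_apply, twist_tmul]

/-- `Ψ₀₁(v ⊗ t) = S(t₍₁₎ v) ⊗ t₍₀₎`. -/
def Ψ₀₁ : CT →⋆ₐ[ℂ] CT := (swap Toeplitz CS1).comp Ψ₀₂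

/-- `Ψ₁₂(t ⊗ v) = t₍₀₎ ⊗ S(t₍₁₎ v)`. -/
def Ψ₁₂ : TC →⋆ₐ[ℂ] TC := Ψ₀₂.comp (swap Toeplitz CS1)

theorem Ψ₁₂_tmul (t : Toeplitz) (v : CS1) :
    Ψ₁₂ (tmul t v) = map (StarAlgHom.id ℂ Toeplitz) CS1.antipode (coaction t * tmul 1 v) := by
  rw [Ψ₁₂, StarAlgHom.comp_apply, swap_tmul, Ψ₀₂_tmul]

/-- The triple-pullback C*-algebra `C(ℂP²_𝒯)`. -/
def C : StarSubalgebra ℂ (TT × TT × TT) :=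
  triplePullback σ₁ (Ψ₀₁.comp σ₁) σ₂ (Ψ₀₂.comp σ₁) σ₂ (Ψ₁₂.comp σ₂)

end ProjectivePlane

end QuantumPlane

end

/-!
Each component `C(S¹) ⊗ 𝒯 ⊗ 𝒯`, `𝒯 ⊗ C(S¹) ⊗ 𝒯`, `𝒯 ⊗ 𝒯 ⊗ C(S¹)` of the sphere is an algebra of
continuous functions `F` on the circle with values in `𝒯 ⊗ 𝒯`. In this picture `g` acts by
`(g F)(z) = γ_g (F (z g))`, where `γ` is the diagonal gauge action on `𝒯 ⊗ 𝒯`, so that the invariant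
functions are the orbit maps `z ↦ γ_{z⁻¹} b`, and an orbit map is determined by its value `b` at `1`.
Sending a triple `(b₀, b₁, b₂)` to its orbit maps therefore identifies `(𝒯 ⊗ 𝒯)³` with the invariant
triples, and it remains to compare the gluing conditions. A gluing condition of the sphere is an
equation in an algebra with two circle factors; evaluated at `z` in one of them, it becomes the
corresponding gluing condition of the projective plane, transformed by the action of `z⁻¹`. The
twists `Ψ` appear because the two sides are normalised at the point `1` of different circle factors.

To speak of values in a minimal tensor product, it is shown that evaluations exist and determine
the norm. For `C(S¹) ⊗ X` this is `isNorming_evalCircle`. For a circle factor inside a threefold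
product it follows by reassociation: `assocCircle` is injective because the representations
`π ⊗ ρ` of `A ⊗ B`, composed with an evaluation, factor through `(C(S¹) ⊗ A) ⊗ B`
(`rep_evalCircle`), and it is surjective because its range is closed and contains the elementary
tensors. The orbit maps are constructed in `IsNorming.exists_orbitHom` from the universal property
of `𝒯`, and the norm bound needed to extend them to the minimal tensor product is checked pointwise.
Invariance is treated in `IsNorming.fixed_iff_exists_orbitHom` and gluing in `IsNorming.glue_iff`.
All identities between homomorphisms are verified on the generators `s ⊗ 1` and `1 ⊗ s`.
-/

noncomputable section

open scoped TensorProduct ComplexConjugate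
open UniformSpace

namespace QuantumPlane

/-! ### Norming families of homomorphisms -/

/-- A family of `*`-homomorphisms out of `Y` that determines the norm of `Y`. -/
def IsNorming {I Y X : Type} [CStarAlgebra Y] [CStarAlgebra X] (E : I → Y →⋆ₐ[ℂ] X) : Prop :=
  ∀ (y : Y) (M : ℝ), (∀ i, ‖E i y‖ ≤ M) → ‖y‖ ≤ M

namespace IsNorming

variable {I Y X : Type} [CStarAlgebra Y] [CStarAlgebra X] {E : I → Y →⋆ₐ[ℂ] X}

theorem ext (hE : IsNorming E) {x y : Y} (h : ∀ i, E i x = E i y) : x = y := by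
  rw [← sub_eq_zero, ← norm_le_zero_iff]
  exact hE _ _ fun i => by rw [map_sub, h, sub_self, norm_zero]

theorem comp (hE : IsNorming E) {Z : Type} [CStarAlgebra Z] (f : Z →⋆ₐ[ℂ] Y)
    (hf : Function.Injective f) : IsNorming fun i => (E i).comp f := fun z M h => by
  rw [← NonUnitalStarAlgHom.norm_map f hf]
  exact hE _ _ h

end IsNorming

/-! ### Evaluation of circle variables in minimal tensor products -/

namespace MinTensor

variable {A B : Type} [CStarAlgebra A] [CStarAlgebra B]

variable (A B) in
/-- Evaluation of the circle variable: the `*`-homomorphism `f ⊗ x ↦ f(z) x`. -/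
def evalCircle (z : Circle) : MinTensor CS1 (MinTensor A B) →⋆ₐ[ℂ] MinTensor A B :=
  circleLift (charHom _ z) (StarAlgHom.id ℂ _) fun f x => charHom_commute z f (StarAlgHom.id ℂ _ x)

theorem evalCircle_tmul (z : Circle) (f : CS1) (x : MinTensor A B) :
    evalCircle A B z (tmul f x) = f z • x := by
  rw [evalCircle, circleLift_tmul, charHom_apply, ← Algebra.smul_def, StarAlgHom.coe_id, id]

/-- The norm of `C(S¹) ⊗ X` is the supremum norm of `C(S¹, X)`. -/
theorem isNorming_evalCircle : IsNorming (evalCircle A B) := by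
  -- The bound for elements of the algebraic tensor product, which are dense.
  have key : ∀ (x : CS1 ⊗[ℂ] MinTensor A B) (M : ℝ),
      (∀ z, ‖evalCircle A B z (of _ _ x)‖ ≤ M) → ‖of _ _ x‖ ≤ M := fun x M hM => by
    have e : of CS1 (MinTensor A B) x = algLift (inl _ _) (inr _ _) commute_inl_inr x :=
      alg_hom_ext (f := of _ _) (fun f a => by rw [algLift_tmul, inl_mul_inr]; rfl) x
    rw [e]
    refine norm_algLift_le _ _ _ x fun z => ?_
    have e' : algLift (charHom (MinTensor CS1 (MinTensor A B)) z) (inr CS1 (MinTensor A B))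
        (fun f a => charHom_commute z f _) x = inr _ _ (evalCircle A B z (of _ _ x)) :=
      alg_hom_ext (g := ((inr _ _).comp (evalCircle A B z)).comp (of _ _)) (fun f a => by
        have : evalCircle A B z (of _ _ (f ⊗ₜ a)) = f z • a := evalCircle_tmul z f a
        rw [algLift_tmul, charHom_apply, StarAlgHom.comp_apply, StarAlgHom.comp_apply, this,
          map_smul, ← Algebra.smul_def]) x
    rw [e']
    exact (NonUnitalStarAlgHom.norm_apply_le (inr CS1 (MinTensor A B)) _).trans (hM z)
  intro y M hM
  refine le_of_forall_pos_le_add fun ε hε => ?_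
  obtain ⟨x, hx⟩ := (tensorFamily CS1 (MinTensor A B)).denseRange_of.exists_dist_lt y (half_pos hε)
  change dist y (of _ _ x) < ε / 2 at hx
  rw [dist_eq_norm] at hx
  have h1 : ‖of _ _ x‖ ≤ M + ε / 2 := key x _ fun z => by
    have e : evalCircle A B z (of _ _ x) = evalCircle A B z y - evalCircle A B z (y - of _ _ x) := by
      rw [map_sub, sub_sub_cancel]
    rw [e]
    exact (norm_sub_le _ _).trans (add_le_add (hM z)
      ((NonUnitalStarAlgHom.norm_apply_le (evalCircle A B z) _).trans hx.le))
  calc ‖y‖ = ‖(y - of _ _ x) + of _ _ x‖ := by rw [sub_add_cancel]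
    _ ≤ ‖y - of _ _ x‖ + ‖of _ _ x‖ := norm_add_le _ _
    _ ≤ M + ε := by linarith

variable (A B) in
/-- The reassociation `f ⊗ (a ⊗ b) ↦ (f ⊗ a) ⊗ b`. -/
def assocCircle : MinTensor CS1 (MinTensor A B) →⋆ₐ[ℂ] MinTensor (MinTensor CS1 A) B :=
  circleLift ((inl _ _).comp (inl _ _)) (map (inr _ _) (StarAlgHom.id ℂ _)) fun f x => by
    refine MinTensor.induction (p := fun x => Commute _ (map (inr CS1 A) (StarAlgHom.id ℂ B) x)) x
      ?_ fun x => ?_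
    · have : Continuous (map (inr CS1 A) (StarAlgHom.id ℂ B)) :=
        NonUnitalStarAlgHom.instContinuousLinearMapClassComplex.map_continuous _
      exact isClosed_eq (by fun_prop) (by fun_prop)
    induction x using TensorProduct.induction_on with
    | zero => rw [map_zero, map_zero]; exact Commute.zero_right _
    | add x y hx hy => rw [map_add, map_add]; exact hx.add_right hy
    | tmul a b =>
      have e : map (inr CS1 A) (StarAlgHom.id ℂ B) (of A B (a ⊗ₜ b)) = tmul (tmul 1 a) b :=
        map_tmul _ _ _ _
      show tmul (tmul f 1) 1 * _ = _ * tmul (tmul f 1) 1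
      rw [e]
      simp only [tmul_mul, one_mul, mul_one]

theorem assocCircle_tmul (f : CS1) (a : A) (b : B) :
    assocCircle A B (tmul f (tmul a b)) = tmul (tmul f a) b := by
  rw [assocCircle, circleLift_tmul, map_tmul]
  show tmul (tmul f 1) 1 * tmul (tmul 1 a) b = _
  simp only [tmul_mul, one_mul, mul_one]

theorem hom_ext_assoc {C D : Type} [CStarAlgebra C] [CStarAlgebra D]
    {f g : MinTensor C (MinTensor A B) →⋆ₐ[ℂ] D}
    (h : ∀ c a b, f (tmul c (tmul a b)) = g (tmul c (tmul a b))) : f = g := by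
  have hr : f.comp (inr _ _) = g.comp (inr _ _) := hom_ext fun a b => h 1 a b
  have hl : ∀ c, f (inl _ _ c) = g (inl _ _ c) := fun c => by
    have := h c 1 1
    rwa [← one_def] at this
  refine hom_ext fun c x => ?_
  rw [← inl_mul_inr, map_mul, map_mul, hl]
  exact congrArg _ (DFunLike.congr_fun hr x)

theorem hom_ext_assoc_left {C D : Type} [CStarAlgebra C] [CStarAlgebra D]
    {f g : MinTensor (MinTensor A B) C →⋆ₐ[ℂ] D}
    (h : ∀ a b c, f (tmul (tmul a b) c) = g (tmul (tmul a b) c)) : f = g := by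
  have hl : f.comp (inl _ _) = g.comp (inl _ _) := hom_ext fun a b => h a b 1
  have hr : ∀ c, f (inr _ _ c) = g (inr _ _ c) := fun c => by
    have := h 1 1 c
    rwa [← one_def] at this
  refine hom_ext fun x c => ?_
  rw [← inl_mul_inr, map_mul, map_mul, hr]
  exact congrArg (· * _) (DFunLike.congr_fun hl x)

theorem norm_algLift_charHom_le (z : Circle) (π : HilbertRep A) (x : CS1 ⊗[ℂ] A) :
    ‖algLift (charHom _ z) π.π (fun f a => charHom_commute z f (π.π a)) x‖ ≤ ‖of CS1 A x‖ := by
  have key : opRight ℂ π.space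
      (algLift (charHom _ z) π.π (fun f a => charHom_commute z f (π.π a)) x) =
        pairRep (charRep z) π x := by
    induction x using TensorProduct.induction_on with
    | zero => rw [map_zero, map_zero, map_zero]; rfl
    | add x y hx hy => rw [map_add, map_add, map_add, hx, hy]; rfl
    | tmul f a =>
      rw [algLift_tmul, pairRep_tmul, map_mul, charHom_apply, Algebra.algebraMap_eq_smul_one,
        map_smul, map_one]
      have : (charRep z).π f = f z • 1 := by
        rw [← Algebra.algebraMap_eq_smul_one]; rfl
      rw [this, map_smul, map_one]
      rfl
  rw [← NonUnitalStarAlgHom.norm_map _ (opRight_injective π.space), key]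
  exact norm_pairRep_le (charRep z) π x

/-- The `*`-homomorphism `f ⊗ a ↦ f(z) π(a)`. -/
def evalRepHom (z : Circle) (π : HilbertRep A) : MinTensor CS1 A →⋆ₐ[ℂ] BOp π.space :=
  lift (algLift (charHom _ z) π.π fun f a => charHom_commute z f (π.π a))
    (norm_algLift_charHom_le z π)

theorem evalRepHom_tmul (z : Circle) (π : HilbertRep A) (f : CS1) (a : A) :
    evalRepHom z π (tmul f a) = f z • π.π a := by
  rw [evalRepHom, tmul, lift_of, algLift_tmul, charHom_apply, ← Algebra.smul_def]

/-- The representation `f ⊗ a ↦ f(z) π(a)` of `C(S¹) ⊗ A` on the space of `π`. -/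
def evalRep (z : Circle) (π : HilbertRep A) : HilbertRep (MinTensor CS1 A) where
  space := π.space
  π := evalRepHom z π

theorem rep_tmul (π : HilbertRep A) (ρ : HilbertRep B) (a : A) (b : B) :
    rep π ρ (tmul a b) = opLeft π.space ρ.space (π.π a) * opRight π.space ρ.space (ρ.π b) := by
  rw [rep, tmul, lift_of, pairRep_tmul]

theorem rep_evalCircle (z : Circle) (π : HilbertRep A) (ρ : HilbertRep B)
    (y : MinTensor CS1 (MinTensor A B)) :
    rep π ρ (evalCircle A B z y) = rep (evalRep z π) ρ (assocCircle A B y) := by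
  let g : MinTensor CS1 (MinTensor A B) →⋆ₐ[ℂ] BOp (HilbertTensor π.space ρ.space) :=
    (rep (evalRep z π) ρ).comp (assocCircle A B)
  have hg : ∀ f a b, g (tmul f (tmul a b)) =
      opLeft π.space ρ.space (evalRepHom z π (tmul f a)) * opRight π.space ρ.space (ρ.π b) :=
    fun f a b => (congrArg (rep (evalRep z π) ρ) (assocCircle_tmul f a b)).trans
      (rep_tmul (evalRep z π) ρ _ _)
  refine DFunLike.congr_fun (hom_ext_assoc (f := (rep π ρ).comp (evalCircle A B z))
    (g := g) fun f a b => ?_) y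
  rw [hg, StarAlgHom.comp_apply, evalCircle_tmul, map_smul, rep_tmul, evalRepHom_tmul, map_smul,
    smul_mul_assoc]

/-- A function is controlled by its values, whose norms are computed in the representations
`π ⊗ ρ`; these are the representations of `(C(S¹) ⊗ A) ⊗ B` obtained from `evalRep z π` and `ρ`. -/
theorem assocCircle_injective : Function.Injective (assocCircle A B) := by
  refine (injective_iff_map_eq_zero _).2 fun y hy => ?_
  refine norm_le_zero_iff.1 (isNorming_evalCircle y 0 fun z => norm_le_of_rep fun π ρ => ?_)
  rw [rep_evalCircle, hy, map_zero]
  exact norm_zero.le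

theorem assocCircle_surjective : Function.Surjective (assocCircle A B) := by
  have hcl : IsClosed (Set.range (assocCircle A B)) :=
    (NonUnitalStarAlgHom.isometry (assocCircle A B)
      assocCircle_injective).isClosedEmbedding.isClosed_range
  have hr : ∀ x, x ∈ Set.range (assocCircle A B) ↔ x ∈ (assocCircle A B).range := fun x => Iff.rfl
  -- The range contains `x ⊗ 1` for all `x` and `1 ⊗ b` for all `b`, and these generate.
  have h1 : ∀ x : MinTensor CS1 A, inl _ B x ∈ Set.range (assocCircle A B) := fun x => by
    refine MinTensor.induction x (hcl.preimage
      (NonUnitalStarAlgHom.instContinuousLinearMapClassComplex.map_continuous (inl _ B)))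
      fun x => ?_
    induction x using TensorProduct.induction_on with
    | zero => rw [map_zero, map_zero]; exact ⟨0, map_zero _⟩
    | add x y hx hy => rw [hr] at *; rw [map_add, map_add]; exact add_mem hx hy
    | tmul f a => exact ⟨tmul f (tmul a 1), assocCircle_tmul f a 1⟩
  intro x
  refine MinTensor.induction (p := fun x => x ∈ Set.range (assocCircle A B)) x hcl fun x => ?_
  induction x using TensorProduct.induction_on with
  | zero => rw [map_zero]; exact ⟨0, map_zero _⟩
  | add x y hx hy => rw [hr] at *; rw [map_add]; exact add_mem hx hy
  | tmul y b =>
    have hb : inr (MinTensor CS1 A) B b ∈ (assocCircle A B).range :=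
      ⟨tmul 1 (tmul 1 b), (assocCircle_tmul _ _ _).trans (by rw [← one_def]; rfl)⟩
    have := mul_mem ((hr _).1 (h1 y)) hb
    rw [inl_mul_inr] at this
    exact this

variable (A B) in
/-- Evaluation of the first of three variables: `(f ⊗ a) ⊗ b ↦ f(z) a ⊗ b`. -/
def evalFirst (z : Circle) : MinTensor (MinTensor CS1 A) B →⋆ₐ[ℂ] MinTensor A B :=
  (evalCircle A B z).comp (StarAlgEquiv.ofBijective (assocCircle A B)
    ⟨assocCircle_injective, assocCircle_surjective⟩).symm.toStarAlgHom

theorem evalFirst_tmul (z : Circle) (f : CS1) (a : A) (b : B) :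
    evalFirst A B z (tmul (tmul f a) b) = f z • tmul a b := by
  rw [← evalCircle_tmul, ← assocCircle_tmul]
  exact congrArg (evalCircle A B z) (StarAlgEquiv.symm_apply_apply
    (StarAlgEquiv.ofBijective (assocCircle A B) ⟨assocCircle_injective, assocCircle_surjective⟩) _)

theorem isNorming_evalFirst : IsNorming (evalFirst A B) :=
  isNorming_evalCircle.comp _ (show Function.Injective (StarAlgEquiv.ofBijective (assocCircle A B)
    ⟨assocCircle_injective, assocCircle_surjective⟩).symm from EquivLike.injective _)

theorem swap_swap : (swap B A).comp (swap A B) = StarAlgHom.id ℂ _ :=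
  hom_ext fun a b => by rw [StarAlgHom.comp_apply, swap_tmul, swap_tmul]; rfl

variable (A B) in
/-- Evaluation of the second of three variables: `(a ⊗ f) ⊗ b ↦ f(z) a ⊗ b`. -/
def evalSecond (z : Circle) : MinTensor (MinTensor A CS1) B →⋆ₐ[ℂ] MinTensor A B :=
  (evalFirst A B z).comp (map (swap _ _) (StarAlgHom.id ℂ _))

theorem evalSecond_tmul (z : Circle) (f : CS1) (a : A) (b : B) :
    evalSecond A B z (tmul (tmul a f) b) = f z • tmul a b := by
  rw [evalSecond, StarAlgHom.comp_apply, map_tmul, swap_tmul]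
  exact evalFirst_tmul z f a b

theorem isNorming_evalSecond : IsNorming (evalSecond A B) := by
  refine isNorming_evalFirst.comp _ (Function.LeftInverse.injective
    (g := map (swap _ _) (StarAlgHom.id ℂ _)) fun x => ?_)
  rw [← StarAlgHom.comp_apply, map_comp, swap_swap]
  exact DFunLike.congr_fun map_id x

variable (A B) in
/-- Evaluation of the last of three variables: `(a ⊗ b) ⊗ f ↦ f(z) a ⊗ b`. -/
def evalThird (z : Circle) : MinTensor (MinTensor A B) CS1 →⋆ₐ[ℂ] MinTensor A B :=
  (evalCircle A B z).comp (swap _ _)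

theorem evalThird_tmul (z : Circle) (f : CS1) (a : A) (b : B) :
    evalThird A B z (tmul (tmul a b) f) = f z • tmul a b := by
  rw [evalThird, StarAlgHom.comp_apply, swap_tmul, evalCircle_tmul]

theorem isNorming_evalThird : IsNorming (evalThird A B) :=
  isNorming_evalCircle.comp _ (Function.LeftInverse.injective (g := swap _ _) fun x =>
    DFunLike.congr_fun swap_swap x)

end MinTensor
/-! ### Generators of the algebras and values on them -/

namespace MinTensor

variable {A B : Type} [CStarAlgebra A] [CStarAlgebra B]

theorem smul_tmul (c : ℂ) (a : A) (b : B) : tmul (c • a) b = c • tmul a b := by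
  rw [tmul, ← TensorProduct.smul_tmul', map_smul]; rfl

theorem tmul_smul (c : ℂ) (a : A) (b : B) : tmul a (c • b) = c • tmul a b := by
  rw [tmul, TensorProduct.tmul_smul, map_smul]; rfl

end MinTensor

theorem CS1.star_u_apply (z : Circle) : (star CS1.u) z = ((z⁻¹ : Circle) : ℂ) :=
  (Circle.coe_inv_eq_conj z).symm

theorem CS1.u_apply (z : Circle) : CS1.u z = (z : ℂ) := rfl

theorem CS1.rot_u (g : Circle) : CS1.rot g CS1.u = (g : ℂ) • CS1.u := by
  ext z
  show ((z * g : Circle) : ℂ) = (g : ℂ) * (z : ℂ)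
  rw [Circle.coe_mul, mul_comm]

theorem CS1.rot_star_u (g : Circle) :
    CS1.rot g (star CS1.u) = ((g⁻¹ : Circle) : ℂ) • star CS1.u := by
  ext z
  show (star CS1.u) (z * g) = _ * (star CS1.u) z
  rw [CS1.star_u_apply, CS1.star_u_apply, mul_inv, Circle.coe_mul, mul_comm]

theorem CS1.antipode_u : CS1.antipode CS1.u = star CS1.u := by
  ext z
  rw [CS1.antipode_apply, CS1.star_u_apply]; rfl

open MinTensor Toeplitz

theorem Toeplitz.symbol_s : symbol s = CS1.u := lift_s _ _

/-- `s ⊗ 1` and `1 ⊗ s` generate `𝒯 ⊗ 𝒯`. -/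
theorem toeplitzTensor_hom_ext {D : Type} [CStarAlgebra D]
    {f g : MinTensor Toeplitz Toeplitz →⋆ₐ[ℂ] D} (h₁ : f (tmul s 1) = g (tmul s 1))
    (h₂ : f (tmul 1 s) = g (tmul 1 s)) : f = g := by
  have hl : f.comp (inl _ _) = g.comp (inl _ _) := Toeplitz.hom_ext h₁
  have hr : f.comp (inr _ _) = g.comp (inr _ _) := Toeplitz.hom_ext h₂
  refine MinTensor.hom_ext fun a b => ?_
  rw [← inl_mul_inr, map_mul, map_mul]
  exact congrArg₂ (· * ·) (DFunLike.congr_fun hl a) (DFunLike.congr_fun hr b)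

/-- The diagonal gauge action on `𝒯 ⊗ 𝒯`. -/
abbrev gauge₂ (g : Circle) :
    MinTensor Toeplitz Toeplitz →⋆ₐ[ℂ] MinTensor Toeplitz Toeplitz := map (gauge g) (gauge g)

theorem gauge₂_mul (g h : Circle) (b : MinTensor Toeplitz Toeplitz) :
    gauge₂ (g * h) b = gauge₂ g (gauge₂ h b) := by
  rw [gauge₂, gauge_mul, ← map_comp]; rfl

theorem gauge₂_one (b : MinTensor Toeplitz Toeplitz) : gauge₂ 1 b = b := by
  rw [gauge₂, gauge_one, map_id]; rfl

/-! ### Orbit maps and fixed points -/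

section orbit

variable {Y : Type} [CStarAlgebra Y] {E : Circle → Y →⋆ₐ[ℂ] MinTensor Toeplitz Toeplitz}

/-- For elements `v` and `w` of an algebra of functions `Circle → 𝒯 ⊗ 𝒯` that equal
`z ↦ z⁻¹ s ⊗ 1` and `z ↦ z⁻¹ 1 ⊗ s`, there is a `*`-homomorphism that takes `b` to its orbit map
`z ↦ gauge₂ z⁻¹ b`. It is specified here on the generators; `eval_orbitHom` gives the formula. -/
theorem IsNorming.exists_orbitHom (hE : IsNorming E) {v w : Y}
    (hv : ∀ z, E z v = ((z⁻¹ : Circle) : ℂ) • tmul s 1)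
    (hw : ∀ z, E z w = ((z⁻¹ : Circle) : ℂ) • tmul 1 s) :
    ∃ θ : MinTensor Toeplitz Toeplitz →⋆ₐ[ℂ] Y, θ (tmul s 1) = v ∧ θ (tmul 1 s) = w := by
  have hv' : ∀ z, E z v = inl Toeplitz Toeplitz (gauge z⁻¹ s) := fun z => by
    rw [hv, gauge_s, map_smul]; rfl
  have hw' : ∀ z, E z w = inr Toeplitz Toeplitz (gauge z⁻¹ s) := fun z => by
    rw [hw, gauge_s, map_smul]; rfl
  have hv1 : star v * v = 1 := hE.ext fun z => by
    rw [map_mul, map_star, map_one, hv', ← map_star, ← map_mul, ← map_star, ← map_mul, star_s_mul_s,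
      map_one, map_one]
  have hw1 : star w * w = 1 := hE.ext fun z => by
    rw [map_mul, map_star, map_one, hw', ← map_star, ← map_mul, ← map_star, ← map_mul, star_s_mul_s,
      map_one, map_one]
  let φ := Toeplitz.lift v hv1
  let ψ := Toeplitz.lift w hw1
  have hφ : ∀ z a, E z (φ a) = inl _ _ (gauge z⁻¹ a) := fun z => DFunLike.congr_fun
    (Toeplitz.hom_ext (f := (E z).comp φ) (g := (inl _ _).comp (gauge z⁻¹))
      ((congrArg (E z) (lift_s v hv1)).trans (hv' z)))
  have hψ : ∀ z a, E z (ψ a) = inr _ _ (gauge z⁻¹ a) := fun z => DFunLike.congr_fun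
    (Toeplitz.hom_ext (f := (E z).comp ψ) (g := (inr _ _).comp (gauge z⁻¹))
      ((congrArg (E z) (lift_s w hw1)).trans (hw' z)))
  have hc : ∀ a b, Commute (φ a) (ψ b) := fun a b => hE.ext fun z => by
    rw [map_mul, map_mul, hφ, hψ]
    exact commute_inl_inr _ _
  have hb : ∀ x, ‖algLift φ ψ hc x‖ ≤ ‖of Toeplitz Toeplitz x‖ := fun x => hE _ _ fun z => by
    have e : E z (algLift φ ψ hc x) = gauge₂ z⁻¹ (of _ _ x) :=
      alg_hom_ext (f := (E z).comp (algLift φ ψ hc)) (g := (gauge₂ z⁻¹).comp (of _ _))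
        (fun a b => by
          rw [StarAlgHom.comp_apply, algLift_tmul, map_mul, hφ, hψ, inl_mul_inr]
          exact (map_tmul _ _ _ _).symm) x
    rw [e]
    exact NonUnitalStarAlgHom.norm_apply_le (gauge₂ z⁻¹) _
  refine ⟨MinTensor.lift (algLift φ ψ hc) hb, ?_, ?_⟩
  · rw [tmul, lift_of, algLift_tmul, map_one, mul_one]; exact lift_s _ _
  · rw [tmul, lift_of, algLift_tmul, map_one, one_mul]; exact lift_s _ _

variable {θ : MinTensor Toeplitz Toeplitz →⋆ₐ[ℂ] Y}

theorem eval_orbitHom (h₁ : ∀ z, E z (θ (tmul s 1)) = ((z⁻¹ : Circle) : ℂ) • tmul s 1)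
    (h₂ : ∀ z, E z (θ (tmul 1 s)) = ((z⁻¹ : Circle) : ℂ) • tmul 1 s) (z : Circle)
    (b : MinTensor Toeplitz Toeplitz) : E z (θ b) = gauge₂ z⁻¹ b := by
  refine DFunLike.congr_fun (toeplitzTensor_hom_ext (f := (E z).comp θ) ?_ ?_) b
  · rw [StarAlgHom.comp_apply, h₁, map_tmul, gauge_s, map_one, smul_tmul]
  · rw [StarAlgHom.comp_apply, h₂, map_tmul, gauge_s, map_one, tmul_smul]

theorem orbitHom_injective (hθ : ∀ z b, E z (θ b) = gauge₂ z⁻¹ b) : Function.Injective θ := by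
  refine Function.LeftInverse.injective (g := E 1) fun b => ?_
  rw [hθ, inv_one, gauge₂_one]

/-- The fixed points of an action that is translation in the circle variable combined with the
gauge action on the values are the orbit maps. -/
theorem IsNorming.fixed_iff_exists_orbitHom (hE : IsNorming E)
    (hθ : ∀ z b, E z (θ b) = gauge₂ z⁻¹ b) {act : Circle → Y →⋆ₐ[ℂ] Y}
    (hact : ∀ z g y, E z (act g y) = gauge₂ g (E (z * g) y)) (y : Y) :
    (∀ g, act g y = y) ↔ ∃ b, θ b = y := by
  constructor
  · refine fun h => ⟨E 1 y, hE.ext fun z => ?_⟩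
    rw [hθ]
    conv_rhs => rw [← h z⁻¹, hact, mul_inv_cancel]
  · rintro ⟨b, rfl⟩ g
    refine hE.ext fun z => ?_
    rw [hact, hθ, hθ, ← gauge₂_mul, mul_inv, mul_comm z⁻¹, mul_inv_cancel_left]

end orbit

/-! ### Gluing conditions -/

/-- Gluing conditions can be compared at the point `1` of the circle when both sides are orbit
maps for the same family `R` of homomorphisms. -/
theorem IsNorming.glue_iff {Y X A A' : Type} [CStarAlgebra Y] [CStarAlgebra X] [CStarAlgebra A]
    [CStarAlgebra A'] {E : Circle → Y →⋆ₐ[ℂ] X} (hE : IsNorming E) {R : Circle → X →⋆ₐ[ℂ] X}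
    (hR : R 1 = StarAlgHom.id ℂ X) {P : A →⋆ₐ[ℂ] Y} {Q : A' →⋆ₐ[ℂ] Y} {p : A →⋆ₐ[ℂ] X}
    {q : A' →⋆ₐ[ℂ] X} (hP : ∀ z, (E z).comp P = (R z).comp p)
    (hQ : ∀ z, (E z).comp Q = (R z).comp q) (a : A) (a' : A') : P a = Q a' ↔ p a = q a' := by
  have hP' : ∀ z, E z (P a) = R z (p a) := fun z => DFunLike.congr_fun (hP z) a
  have hQ' : ∀ z, E z (Q a') = R z (q a') := fun z => DFunLike.congr_fun (hQ z) a'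
  refine ⟨fun h => ?_, fun h => hE.ext fun z => by rw [hP', hQ', h]⟩
  have h1 := hP' 1
  rw [h, hQ', hR] at h1
  exact h1.symm

/-! ### The action on the sphere in the function picture -/

namespace Sphere

theorem evalFirst_act₀ (z g : Circle) (y : B₀) :
    evalFirst Toeplitz Toeplitz z (act₀ g y) = gauge₂ g (evalFirst _ _ (z * g) y) := by
  refine DFunLike.congr_fun (hom_ext_assoc_left (f := (evalFirst Toeplitz Toeplitz z).comp (act₀ g))
    (g := (gauge₂ g).comp (evalFirst _ _ (z * g))) fun f a b => ?_) y
  rw [StarAlgHom.comp_apply, StarAlgHom.comp_apply, act₀, map_tmul, map_tmul, evalFirst_tmul,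
    evalFirst_tmul, map_smul, map_tmul, CS1.rot_apply]

theorem evalSecond_act₁ (z g : Circle) (y : B₁) :
    evalSecond Toeplitz Toeplitz z (act₁ g y) = gauge₂ g (evalSecond _ _ (z * g) y) := by
  refine DFunLike.congr_fun (hom_ext_assoc_left
    (f := (evalSecond Toeplitz Toeplitz z).comp (act₁ g))
    (g := (gauge₂ g).comp (evalSecond _ _ (z * g))) fun a f b => ?_) y
  rw [StarAlgHom.comp_apply, StarAlgHom.comp_apply, act₁, map_tmul, map_tmul, evalSecond_tmul,
    evalSecond_tmul, map_smul, map_tmul, CS1.rot_apply]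

theorem evalThird_act₂ (z g : Circle) (y : B₂) :
    evalThird Toeplitz Toeplitz z (act₂ g y) = gauge₂ g (evalThird _ _ (z * g) y) := by
  refine DFunLike.congr_fun (hom_ext_assoc_left (f := (evalThird Toeplitz Toeplitz z).comp (act₂ g))
    (g := (gauge₂ g).comp (evalThird _ _ (z * g))) fun a b f => ?_) y
  rw [StarAlgHom.comp_apply, StarAlgHom.comp_apply, act₂, map_tmul, map_tmul, evalThird_tmul,
    evalThird_tmul, map_smul, map_tmul, CS1.rot_apply]

end Sphere

/-! ### The gluing conditions of the sphere and of the plane -/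

section glue

open Sphere ProjectivePlane

variable {θ₀ : TT →⋆ₐ[ℂ] B₀} {θ₁ : TT →⋆ₐ[ℂ] B₁} {θ₂ : TT →⋆ₐ[ℂ] B₂}

theorem ProjectivePlane.Ψ₀₂_u_one : Ψ₀₂ (tmul CS1.u 1) = tmul 1 (star CS1.u) := by
  rw [Ψ₀₂_tmul, map_one, one_mul, map_tmul, CS1.antipode_u]; rfl

theorem ProjectivePlane.Ψ₀₂_one_s : Ψ₀₂ (tmul 1 s) = tmul s (star CS1.u) := by
  rw [Ψ₀₂_tmul, coaction_s, tmul_mul, mul_one, mul_one, map_tmul, CS1.antipode_u]; rfl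

theorem rot_gauge_one : map (CS1.rot 1⁻¹) (gauge 1⁻¹) = StarAlgHom.id ℂ CT := by
  rw [inv_one, CS1.rot_one, gauge_one, map_id]

theorem gauge_rot_one : map (gauge 1⁻¹) (CS1.rot 1⁻¹) = StarAlgHom.id ℂ TC := by
  rw [inv_one, CS1.rot_one, gauge_one, map_id]

theorem glue₀₁_iff (h₀ : θ₀ (tmul s 1) = tmul (tmul (star CS1.u) s) 1)
    (h₀' : θ₀ (tmul 1 s) = tmul (tmul (star CS1.u) 1) s)
    (h₁ : θ₁ (tmul s 1) = tmul (tmul s (star CS1.u)) 1)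
    (h₁' : θ₁ (tmul 1 s) = tmul (tmul 1 (star CS1.u)) s) (b b' : TT) :
    π₀₁ (θ₀ b) = π₁₀ (θ₁ b') ↔ σ₁ b = Ψ₀₁ (σ₁ b') := by
  refine isNorming_evalFirst.glue_iff (P := π₀₁.comp θ₀) (Q := π₁₀.comp θ₁) (p := σ₁)
    (q := Ψ₀₁.comp σ₁) (R := fun z => map (CS1.rot z⁻¹) (gauge z⁻¹)) rot_gauge_one
    (fun z => toeplitzTensor_hom_ext ?_ ?_) (fun z => toeplitzTensor_hom_ext ?_ ?_) b b' <;>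
  simp [h₀, h₀', h₁, h₁', π₀₁, π₁₀, σ₁, Ψ₀₁, map_tmul, evalFirst_tmul, symbol_s,
    Ψ₀₂_u_one, Ψ₀₂_one_s, swap_tmul, gauge_s, CS1.rot_u, CS1.rot_star_u, smul_tmul, tmul_smul,
    CS1.u_apply, smul_smul, ← Circle.coe_inv_eq_conj]

theorem glue₀₂_iff (h₀ : θ₀ (tmul s 1) = tmul (tmul (star CS1.u) s) 1)
    (h₀' : θ₀ (tmul 1 s) = tmul (tmul (star CS1.u) 1) s)
    (h₂ : θ₂ (tmul s 1) = tmul (tmul s 1) (star CS1.u))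
    (h₂' : θ₂ (tmul 1 s) = tmul (tmul 1 s) (star CS1.u)) (b b' : TT) :
    π₀₂ (θ₀ b) = π₂₀ (θ₂ b') ↔ σ₂ b = Ψ₀₂ (σ₁ b') := by
  refine isNorming_evalFirst.glue_iff (P := π₀₂.comp θ₀) (Q := π₂₀.comp θ₂) (p := σ₂)
    (q := Ψ₀₂.comp σ₁) (R := fun z => map (gauge z⁻¹) (CS1.rot z⁻¹)) gauge_rot_one
    (fun z => toeplitzTensor_hom_ext ?_ ?_) (fun z => toeplitzTensor_hom_ext ?_ ?_) b b' <;>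
  simp [h₀, h₀', h₂, h₂', π₀₂, π₂₀, σ₁, σ₂, map_tmul, evalFirst_tmul, symbol_s,
    Ψ₀₂_u_one, Ψ₀₂_one_s, gauge_s, CS1.rot_u, CS1.rot_star_u, smul_tmul, tmul_smul,
    CS1.u_apply, smul_smul, ← Circle.coe_inv_eq_conj]

theorem glue₁₂_iff (h₁ : θ₁ (tmul s 1) = tmul (tmul s (star CS1.u)) 1)
    (h₁' : θ₁ (tmul 1 s) = tmul (tmul 1 (star CS1.u)) s)
    (h₂ : θ₂ (tmul s 1) = tmul (tmul s 1) (star CS1.u))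
    (h₂' : θ₂ (tmul 1 s) = tmul (tmul 1 s) (star CS1.u)) (b b' : TT) :
    π₁₂ (θ₁ b) = π₂₁ (θ₂ b') ↔ σ₂ b = Ψ₁₂ (σ₂ b') := by
  refine isNorming_evalSecond.glue_iff (P := π₁₂.comp θ₁) (Q := π₂₁.comp θ₂) (p := σ₂)
    (q := Ψ₁₂.comp σ₂) (R := fun z => map (gauge z⁻¹) (CS1.rot z⁻¹)) gauge_rot_one
    (fun z => toeplitzTensor_hom_ext ?_ ?_) (fun z => toeplitzTensor_hom_ext ?_ ?_) b b' <;>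
  simp [h₁, h₁', h₂, h₂', π₁₂, π₂₁, σ₂, Ψ₁₂, map_tmul, evalSecond_tmul, symbol_s,
    Ψ₀₂_u_one, Ψ₀₂_one_s, swap_tmul, gauge_s, CS1.rot_u, CS1.rot_star_u, smul_tmul, tmul_smul,
    CS1.u_apply, smul_smul, ← Circle.coe_inv_eq_conj]

end glue

/-! ### The isomorphism -/

/-- The orbit maps of the three components give the isomorphism. -/
theorem nonempty_fixedPoints_equiv :
    Nonempty (fixedPointSubalgebra Sphere.diagonalAction ≃⋆ₐ[ℂ] ProjectivePlane.C) := by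
  obtain ⟨θ₀, h₀, h₀'⟩ := isNorming_evalFirst.exists_orbitHom
    (v := tmul (tmul (star CS1.u) s) 1) (w := tmul (tmul (star CS1.u) 1) s)
    (fun z => by rw [evalFirst_tmul, CS1.star_u_apply])
    (fun z => by rw [evalFirst_tmul, CS1.star_u_apply])
  obtain ⟨θ₁, h₁, h₁'⟩ := isNorming_evalSecond.exists_orbitHom
    (v := tmul (tmul s (star CS1.u)) 1) (w := tmul (tmul 1 (star CS1.u)) s)
    (fun z => by rw [evalSecond_tmul, CS1.star_u_apply])
    (fun z => by rw [evalSecond_tmul, CS1.star_u_apply])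
  obtain ⟨θ₂, h₂, h₂'⟩ := isNorming_evalThird.exists_orbitHom
    (v := tmul (tmul s 1) (star CS1.u)) (w := tmul (tmul 1 s) (star CS1.u))
    (fun z => by rw [evalThird_tmul, CS1.star_u_apply])
    (fun z => by rw [evalThird_tmul, CS1.star_u_apply])
  have e₀ := eval_orbitHom (E := evalFirst _ _) (θ := θ₀)
    (fun z => by rw [h₀, evalFirst_tmul, CS1.star_u_apply])
    (fun z => by rw [h₀', evalFirst_tmul, CS1.star_u_apply])
  have e₁ := eval_orbitHom (E := evalSecond _ _) (θ := θ₁)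
    (fun z => by rw [h₁, evalSecond_tmul, CS1.star_u_apply])
    (fun z => by rw [h₁', evalSecond_tmul, CS1.star_u_apply])
  have e₂ := eval_orbitHom (E := evalThird _ _) (θ := θ₂)
    (fun z => by rw [h₂, evalThird_tmul, CS1.star_u_apply])
    (fun z => by rw [h₂', evalThird_tmul, CS1.star_u_apply])
  have f₀ := isNorming_evalFirst.fixed_iff_exists_orbitHom e₀ Sphere.evalFirst_act₀
  have f₁ := isNorming_evalSecond.fixed_iff_exists_orbitHom e₁ Sphere.evalSecond_act₁
  have f₂ := isNorming_evalThird.fixed_iff_exists_orbitHom e₂ Sphere.evalThird_act₂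
  have g₀₁ := glue₀₁_iff h₀ h₀' h₁ h₁'
  have g₀₂ := glue₀₂_iff h₀ h₀' h₂ h₂'
  have g₁₂ := glue₁₂_iff h₁ h₁' h₂ h₂'
  -- A triple is sent to the triple of its orbit maps.
  let Θ : ProjectivePlane.TT × ProjectivePlane.TT × ProjectivePlane.TT →⋆ₐ[ℂ]
      Sphere.B₀ × Sphere.B₁ × Sphere.B₂ :=
    (θ₀.comp (StarAlgHom.fst ℂ _ _)).prod
      ((θ₁.comp ((StarAlgHom.fst ℂ _ _).comp (StarAlgHom.snd ℂ _ _))).prod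
        (θ₂.comp ((StarAlgHom.snd ℂ _ _).comp (StarAlgHom.snd ℂ _ _))))
  -- The gluing conditions of the sphere and of the plane correspond under `Θ`.
  have hΘ : ∀ b, Θ b ∈ Sphere.C ↔ b ∈ ProjectivePlane.C := fun b =>
    and_congr (g₀₁ _ _) (and_congr (g₀₂ _ _) (g₁₂ _ _))
  let F : ProjectivePlane.C →⋆ₐ[ℂ] fixedPointSubalgebra Sphere.diagonalAction :=
    ((Θ.comp ProjectivePlane.C.subtype).codRestrict Sphere.C fun b => (hΘ b).2 b.2).codRestrict
      (fixedPointSubalgebra Sphere.diagonalAction) fun b g => Subtype.ext <|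
        Prod.ext ((f₀ _).2 ⟨_, rfl⟩ g) (Prod.ext ((f₁ _).2 ⟨_, rfl⟩ g) ((f₂ _).2 ⟨_, rfl⟩ g))
  have hF : Function.Bijective F := by
    constructor
    · intro b b' h
      have h' : Θ b = Θ b' := congrArg Subtype.val (congrArg Subtype.val h)
      exact Subtype.ext <| Prod.ext (orbitHom_injective e₀ (congrArg Prod.fst h'))
        (Prod.ext (orbitHom_injective e₁ (congrArg (fun x => x.2.1) h'))
          (orbitHom_injective e₂ (congrArg (fun x => x.2.2) h')))
    · rintro ⟨⟨x, hx⟩, hfix⟩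
      have hfix' : ∀ g, Sphere.actProd g x = x := fun g => congrArg Subtype.val (hfix g)
      obtain ⟨b₀, hb₀⟩ := (f₀ x.1).1 fun g => congrArg Prod.fst (hfix' g)
      obtain ⟨b₁, hb₁⟩ := (f₁ x.2.1).1 fun g => congrArg (fun x => x.2.1) (hfix' g)
      obtain ⟨b₂, hb₂⟩ := (f₂ x.2.2).1 fun g => congrArg (fun x => x.2.2) (hfix' g)
      have hb : Θ (b₀, b₁, b₂) = x := Prod.ext hb₀ (Prod.ext hb₁ hb₂)
      exact ⟨⟨(b₀, b₁, b₂), (hΘ _).1 (hb ▸ hx)⟩, Subtype.ext (Subtype.ext hb)⟩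
  exact ⟨(StarAlgEquiv.ofBijective F hF).symm⟩

end QuantumPlane

end

theorem mainTheorem4 :
    Nonempty
      (QuantumPlane.fixedPointSubalgebra QuantumPlane.Sphere.diagonalAction ≃⋆ₐ[ℂ]
        QuantumPlane.ProjectivePlane.C) :=
  QuantumPlane.nonempty_fixedPoints_equiv
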